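/- Let $\widetilde A,\widetilde B$ be the transformations of the real line $\widetilde A(x)=x-1$ and $\widetilde B(x)=x$ for $x\le 0$, $\widetilde B(x)=x/2$ for $0\le x\le 2$, $\widetilde B(x)=x-1$ for $x\ge 2$, and let $\widetilde F$ (a copy of Thompson's group $F$) be the group generated by $\widetilde A,\widetilde B$, with the product $(g_1g_2)(x)=g_2(g_1(x))$, so that $\widetilde F$ acts on the right by $x.g=g(x)$. Let $\chi_a,\chi_b:\widetilde F\to\mathbb Z$ be the homomorphisms with $\chi_a(\widetilde A)=1$, $\chi_a(\widetilde B)=0$, $\chi_b(\widetilde A)=0$, $\chi_b(\widetilde B)=1$. Let $\Gamma$ be the Schreier graph of the action of $\widetilde F$ on the dyadic rationals $\mathbb Z[\frac12]$ with respect to the generating set $\{\widetilde A^{\pm1},\widetilde B^{\pm1}\}$, and $\partial\Gamma$ its space of ends. Let $\partial_-\Gamma$ be the set of ends determined by the rays $(x-n)_{n\ge1}$ with $x\in\mathbb Z[\frac12]\cap(0,1]$ (the rays of negative type, which fill $(-\infty,0]$), let $\partial_+\Gamma$ be the set of ends determined by the rays $(x+n)_{n\ge1}$ with $x\in\mathbb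 Z[\frac12]\cap[1,2)$ (the rays of positive type, which fill $[2,\infty)$), and let $\partial\overline\Gamma\subset\partial\Gamma$ be the set of ends of the skeleton $\overline\Gamma$, the subgraph of $\Gamma$ induced on the remaining vertices $\mathbb Z[\frac12]\cap(0,2)$. For $A\subset\partial\Gamma$ let $\operatorname{Fun}(\Gamma,A)$ be the set of all maps $\Gamma\to A$. Let $\mu$ be a finitely supported probability measure on $\widetilde F$ whose support generates $\widetilde F$ as a semigroup. Let $\mathbf P$ be the measure on the space of sample paths $(g_n)_{n\ge0}$ of the random walk $g_0=e$, $g_n=h_1h_2\cdots h_n$, where the $h_i$ are independent and $\mu$-distributed. Let $\alpha$ and $\beta$ be the barycentres (expectations) of the images $\chi_a(\mu)$ and $\chi_b(\mu)$ of $\mu$. Then for $\mathbf P$-almost every sample path $(g_n)$ and all $\gamma\in\Gamma$ the sequence $\gamma.g_n$ converges to an end $\omega_\gamma\in\partial\Gamma$. The image $\lambda$ of $\mathbf P$ under the almost everywhere defined map $(g_n)\mapsto(\omega_\gamma)_{\gamma\in\Gamma}$ is a Borel probability measure on $\operatorname{Fun}(\Gamma,\partial\Gamma)$, and it is concentrated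 on $$ \begin{cases} \operatorname{Fun}(\Gamma,\partial_-\Gamma\cup\partial_+\Gamma), & \text{if } \alpha>0 \text{ and } \alpha+\beta<0,\\ \operatorname{Fun}(\Gamma,\partial_-\Gamma), & \text{if } \alpha>0 \text{ and } \alpha+\beta\ge0,\\ \operatorname{Fun}(\Gamma,\partial_+\Gamma), & \text{if } \alpha\le0 \text{ and } \alpha+\beta<0,\\ \operatorname{Fun}(\Gamma,\partial\overline\Gamma), & \text{if } \alpha\le0 \text{ and } \alpha+\beta\ge0. \end{cases} $$ -/

import Mathlib

/-!
Thompson's group in its realization on the real line, its dyadic Schreier graph and the ends of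
that graph, random walks on the group, and the law of the limit end field.
-/

open MeasureTheory Filter

namespace ThompsonEnds

noncomputable section

/-! ## The group -/

/-- The generator `x ↦ x - 1`. -/
def genA : Equiv.Perm ℝ := Equiv.subRight 1

/-- The generator `x ↦ x` for `x ≤ 0`, `x / 2` for `0 ≤ x ≤ 2`, `x - 1` for `x ≥ 2`. -/
def genB : Equiv.Perm ℝ where
  toFun x := if x ≤ 0 then x else if x ≤ 2 then x / 2 else x - 1
  invFun x := if x ≤ 0 then x else if x ≤ 1 then 2 * x else x + 1
  left_inv x := by
    simp only
    split_ifs <;> linarith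
  right_inv x := by
    simp only
    split_ifs <;> linarith

/-- The group of transformations of the line generated by `genA` and `genB`, with the usual
composition of maps as its product. -/
def lineGroup : Subgroup (Equiv.Perm ℝ) := Subgroup.closure {genA, genB}

/-- Thompson's group acting on the line from the right: the opposite of `lineGroup`, so that the
product `g₁ * g₂` is the map `x ↦ g₂ (g₁ x)`. -/
abbrev FTilde : Type := (↥lineGroup)ᵐᵒᵖ

/-- The transformation of the line given by a group element. -/
def toFun (g : FTilde) (x : ℝ) : ℝ := g.unop.1 x

lemma toFun_mul (g₁ g₂ : FTilde) (x : ℝ) : toFun (g₁ * g₂) x = toFun g₂ (toFun g₁ x) := rfl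

lemma toFun_one (x : ℝ) : toFun 1 x = x := rfl

/-- `genA` as a group element. -/
def elA : FTilde := MulOpposite.op ⟨genA, Subgroup.subset_closure (by simp)⟩

/-- `genB` as a group element. -/
def elB : FTilde := MulOpposite.op ⟨genB, Subgroup.subset_closure (by simp)⟩

instance : Countable FTilde := by
  have h : Countable ↥lineGroup := by
    unfold lineGroup
    rw [FreeGroup.closure_eq_range]
    have h2 : Countable (FreeGroup ↥({genA, genB} : Set (Equiv.Perm ℝ))) :=
      Function.Surjective.countable (f := FreeGroup.mk) Quot.mk_surjective
    exact Set.countable_range _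
  exact MulOpposite.unop_injective.countable

instance : MeasurableSpace FTilde := ⊤

instance : DiscreteMeasurableSpace FTilde := ⟨fun _ => trivial⟩

/-! ## The two homomorphisms to the integers -/

lemma genA_apply (x : ℝ) : genA x = x - 1 := rfl

lemma genB_apply (x : ℝ) :
    genB x = if x ≤ 0 then x else if x ≤ 2 then x / 2 else x - 1 := rfl

lemma exists_shift (l : Filter ℝ) (hl : ∀ c : ℤ, Tendsto (fun x : ℝ => x + c) l l)
    (hB : ∃ c : ℤ, ∀ᶠ x in l, genB x = x + c) (g : FTilde) :
    ∃ c : ℤ, ∀ᶠ x in l, toFun g x = x + c := by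
  obtain ⟨g, hg⟩ := g
  change ∃ c : ℤ, ∀ᶠ x in l, g x = x + c
  induction hg using Subgroup.closure_induction with
  | mem x hx =>
    rcases hx with rfl | rfl
    · exact ⟨-1, Eventually.of_forall fun x => by rw [genA_apply]; push_cast; ring⟩
    · exact hB
  | one => exact ⟨0, Eventually.of_forall fun x => by simp⟩
  | mul f g _ _ hf hg =>
    obtain ⟨c, hc⟩ := hf
    obtain ⟨d, hd⟩ := hg
    refine ⟨d + c, ?_⟩
    filter_upwards [hd, (hl d).eventually hc] with x h1 h2
    rw [Equiv.Perm.mul_apply, h1, h2]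
    push_cast
    ring
  | inv f _ hf =>
    obtain ⟨c, hc⟩ := hf
    refine ⟨-c, ?_⟩
    filter_upwards [(hl (-c)).eventually hc] with x h
    rw [Equiv.Perm.inv_eq_iff_eq, h]
    push_cast
    ring

lemma exists_shift_atBot (g : FTilde) : ∃ c : ℤ, ∀ᶠ x in atBot, toFun g x = x + c := by
  refine exists_shift atBot (fun c => tendsto_atBot_add_const_right _ _ tendsto_id) ⟨0, ?_⟩ g
  filter_upwards [eventually_le_atBot (0 : ℝ)] with x hx
  simp [genB_apply, hx]

lemma exists_shift_atTop (g : FTilde) : ∃ c : ℤ, ∀ᶠ x in atTop, toFun g x = x + c := by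
  refine exists_shift atTop (fun c => tendsto_atTop_add_const_right _ _ tendsto_id) ⟨-1, ?_⟩ g
  filter_upwards [eventually_gt_atTop (2 : ℝ)] with x hx
  rw [genB_apply, if_neg (by linarith), if_neg (by linarith)]
  push_cast
  ring

/-- The integer `c` with `g x = x + c` for all `x` close to `-∞`. -/
def shiftBot (g : FTilde) : ℤ := (exists_shift_atBot g).choose

/-- The integer `c` with `g x = x + c` for all `x` close to `+∞`. -/
def shiftTop (g : FTilde) : ℤ := (exists_shift_atTop g).choose

lemma shiftBot_spec (g : FTilde) : ∀ᶠ x in atBot, toFun g x = x + shiftBot g :=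
  (exists_shift_atBot g).choose_spec

lemma shiftTop_spec (g : FTilde) : ∀ᶠ x in atTop, toFun g x = x + shiftTop g :=
  (exists_shift_atTop g).choose_spec

lemma shiftBot_eq {g : FTilde} {c : ℤ} (h : ∀ᶠ x in atBot, toFun g x = x + c) :
    shiftBot g = c := by
  obtain ⟨x, h1, h2⟩ := (h.and (shiftBot_spec g)).exists
  have h3 : (c : ℝ) = shiftBot g := by linarith
  exact_mod_cast h3.symm

lemma shiftTop_eq {g : FTilde} {c : ℤ} (h : ∀ᶠ x in atTop, toFun g x = x + c) :
    shiftTop g = c := by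
  obtain ⟨x, h1, h2⟩ := (h.and (shiftTop_spec g)).exists
  have h3 : (c : ℝ) = shiftTop g := by linarith
  exact_mod_cast h3.symm

lemma shiftBot_mul (f g : FTilde) : shiftBot (f * g) = shiftBot f + shiftBot g := by
  apply shiftBot_eq
  have ht : Tendsto (fun x : ℝ => x + shiftBot f) atBot atBot :=
    tendsto_atBot_add_const_right _ _ tendsto_id
  filter_upwards [shiftBot_spec f, ht.eventually (shiftBot_spec g)] with x h1 h2
  rw [toFun_mul, h1, h2]
  push_cast
  ring

lemma shiftTop_mul (f g : FTilde) : shiftTop (f * g) = shiftTop f + shiftTop g := by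
  apply shiftTop_eq
  have ht : Tendsto (fun x : ℝ => x + shiftTop f) atTop atTop :=
    tendsto_atTop_add_const_right _ _ tendsto_id
  filter_upwards [shiftTop_spec f, ht.eventually (shiftTop_spec g)] with x h1 h2
  rw [toFun_mul, h1, h2]
  push_cast
  ring

lemma shiftBot_one : shiftBot 1 = 0 :=
  shiftBot_eq (Eventually.of_forall fun x => by simp [toFun_one])

lemma shiftTop_one : shiftTop 1 = 0 :=
  shiftTop_eq (Eventually.of_forall fun x => by simp [toFun_one])

/-- The homomorphism to `ℤ` with `elA ↦ 1` and `elB ↦ 0` (see `chiA_elA`, `chiA_elB`). -/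
def chiA : FTilde →* Multiplicative ℤ where
  toFun g := Multiplicative.ofAdd (-shiftBot g)
  map_one' := by simp [shiftBot_one]
  map_mul' f g := by rw [shiftBot_mul, neg_add, ofAdd_add]

/-- The homomorphism to `ℤ` with `elA ↦ 0` and `elB ↦ 1` (see `chiB_elA`, `chiB_elB`). -/
def chiB : FTilde →* Multiplicative ℤ where
  toFun g := Multiplicative.ofAdd (shiftBot g - shiftTop g)
  map_one' := by simp [shiftBot_one, shiftTop_one]
  map_mul' f g := by
    rw [shiftBot_mul, shiftTop_mul, add_sub_add_comm, ofAdd_add]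

lemma shiftBot_elA : shiftBot elA = -1 := by
  refine shiftBot_eq (Eventually.of_forall fun x => ?_)
  change genA x = _
  rw [genA_apply]
  push_cast
  ring

lemma shiftTop_elA : shiftTop elA = -1 := by
  refine shiftTop_eq (Eventually.of_forall fun x => ?_)
  change genA x = _
  rw [genA_apply]
  push_cast
  ring

lemma shiftBot_elB : shiftBot elB = 0 := by
  apply shiftBot_eq
  filter_upwards [eventually_le_atBot (0 : ℝ)] with x hx
  change genB x = _
  simp [genB_apply, hx]

lemma shiftTop_elB : shiftTop elB = -1 := by
  apply shiftTop_eq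
  filter_upwards [eventually_gt_atTop (2 : ℝ)] with x hx
  change genB x = _
  rw [genB_apply, if_neg (by linarith), if_neg (by linarith)]
  push_cast
  ring

lemma chiA_elA : chiA elA = Multiplicative.ofAdd 1 := by
  change Multiplicative.ofAdd (-shiftBot elA) = _
  rw [shiftBot_elA, neg_neg]

lemma chiA_elB : chiA elB = Multiplicative.ofAdd 0 := by
  change Multiplicative.ofAdd (-shiftBot elB) = _
  rw [shiftBot_elB, neg_zero]

lemma chiB_elA : chiB elA = Multiplicative.ofAdd 0 := by
  change Multiplicative.ofAdd (shiftBot elA - shiftTop elA) = _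
  rw [shiftBot_elA, shiftTop_elA, sub_self]

lemma chiB_elB : chiB elB = Multiplicative.ofAdd 1 := by
  change Multiplicative.ofAdd (shiftBot elB - shiftTop elB) = _
  rw [shiftBot_elB, shiftTop_elB, zero_sub, neg_neg]

/-! ## The action on dyadic rationals -/

/-- A real number is a dyadic rational. -/
def IsDyadic (x : ℝ) : Prop := ∃ (m : ℤ) (n : ℕ), x = m / 2 ^ n

lemma IsDyadic.add_int {x : ℝ} (h : IsDyadic x) (c : ℤ) : IsDyadic (x + c) := by
  obtain ⟨m, n, rfl⟩ := h
  refine ⟨m + c * 2 ^ n, n, ?_⟩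
  push_cast
  field_simp

lemma IsDyadic.half {x : ℝ} (h : IsDyadic x) : IsDyadic (x / 2) := by
  obtain ⟨m, n, rfl⟩ := h
  exact ⟨m, n + 1, by rw [pow_succ, div_div]⟩

lemma IsDyadic.double {x : ℝ} (h : IsDyadic x) : IsDyadic (2 * x) := by
  obtain ⟨m, n, rfl⟩ := h
  exact ⟨2 * m, n, by push_cast; ring⟩

lemma isDyadic_add_int_iff {x : ℝ} (c : ℤ) : IsDyadic (x + c) ↔ IsDyadic x := by
  refine ⟨fun h => ?_, fun h => h.add_int c⟩
  have := h.add_int (-c)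
  simpa using this

lemma isDyadic_half_iff {x : ℝ} : IsDyadic (x / 2) ↔ IsDyadic x := by
  refine ⟨fun h => ?_, fun h => h.half⟩
  have := h.double
  rwa [mul_div_cancel₀ x two_ne_zero] at this

lemma isDyadic_sub_one_iff {x : ℝ} : IsDyadic (x - 1) ↔ IsDyadic x := by
  have := isDyadic_add_int_iff (x := x) (-1)
  simpa [← sub_eq_add_neg] using this

lemma isDyadic_toFun (g : FTilde) (x : ℝ) : IsDyadic (toFun g x) ↔ IsDyadic x := by
  obtain ⟨g, hg⟩ := g
  change IsDyadic (g x) ↔ _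
  induction hg using Subgroup.closure_induction generalizing x with
  | mem g hg =>
    rcases hg with rfl | rfl
    · exact isDyadic_sub_one_iff
    · rw [genB_apply]
      split_ifs
      · exact Iff.rfl
      · exact isDyadic_half_iff
      · exact isDyadic_sub_one_iff
  | one => exact Iff.rfl
  | mul f g _ _ hf hg => exact (hf (g x)).trans (hg x)
  | inv f _ hf =>
    have := hf (f⁻¹ x)
    rw [show f (f⁻¹ x) = x from f.apply_symm_apply x] at this
    exact this.symm

/-- The dyadic rationals, the vertex set of the Schreier graph. -/
abbrev Vertex : Type := {x : ℝ // IsDyadic x}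

/-- The right action `x.g = g x` on the dyadic rationals. -/
def act (x : Vertex) (g : FTilde) : Vertex := ⟨toFun g x.1, (isDyadic_toFun g x.1).2 x.2⟩

lemma act_mul (x : Vertex) (f g : FTilde) : act x (f * g) = act (act x f) g := rfl

lemma act_one (x : Vertex) : act x 1 = x := rfl

/-- The dyadic rational `x + c`. -/
def translate (x : Vertex) (c : ℤ) : Vertex := ⟨x.1 + c, x.2.add_int c⟩

/-! ## The Schreier graph, its ends and its skeleton -/

/-- The symmetric generating set. -/
def genSet : Set FTilde := {elA, elB, elA⁻¹, elB⁻¹}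

lemma inv_mem_genSet {g : FTilde} (h : g ∈ genSet) : g⁻¹ ∈ genSet := by
  rcases h with rfl | rfl | rfl | rfl <;> simp [genSet]

/-- The Schreier graph on the dyadic rationals. Loops and multiplicities of edges are dropped;
they are irrelevant for the ends. -/
def schreier : SimpleGraph Vertex where
  Adj x y := x ≠ y ∧ ∃ g ∈ genSet, act x g = y
  symm := ⟨by
    rintro x y ⟨hne, g, hg, rfl⟩
    exact ⟨hne.symm, g⁻¹, inv_mem_genSet hg, by rw [← act_mul, mul_inv_cancel, act_one]⟩⟩
  loopless := ⟨fun x h => h.1 rfl⟩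

/-- The ends of the Schreier graph: compatible choices of a component of the complement of every
finite set of vertices. -/
def Ends : Type := ↥(SimpleGraph.end schreier)

/-- The component of the complement of the finite set `K` chosen by the end `ω`. -/
def Ends.comp (ω : Ends) (K : Finset Vertex) : schreier.ComponentCompl (K : Set Vertex) :=
  ω.1 (Opposite.op K)

/-- The topology of the space of ends: the one induced by the maps `ω ↦ ω.comp K` to discrete
spaces, i.e. the inverse limit topology. -/
instance : TopologicalSpace Ends :=
  TopologicalSpace.induced (fun ω => ω.comp)
    (@Pi.topologicalSpace (Finset Vertex)
      (fun K => schreier.ComponentCompl (K : Set Vertex)) (fun _ => ⊥))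

/-- The Borel σ-algebra of the space of ends. -/
instance : MeasurableSpace Ends := borel Ends

instance : BorelSpace Ends := ⟨rfl⟩

/-- A sequence of vertices converges to the end `ω`: for every finite set `K` it eventually stays
in the component of the complement of `K` chosen by `ω`. -/
def ConvergesToEnd (x : ℕ → Vertex) (ω : Ends) : Prop :=
  ∀ K : Finset Vertex, ∀ᶠ n in atTop, x n ∈ (ω.comp K).supp

lemma ConvergesToEnd.unique {x : ℕ → Vertex} {ω ω' : Ends} (h : ConvergesToEnd x ω)
    (h' : ConvergesToEnd x ω') : ω = ω' := by
  apply Subtype.ext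
  funext K
  obtain ⟨n, ⟨_, h1⟩, ⟨_, h2⟩⟩ := ((h K.unop).and (h' K.unop)).exists
  exact h1.symm.trans h2

/-- The ends of negative type: the limits of the rays `x - 1, x - 2, …`, where `x` runs over
the dyadic rationals in `(0, 1]`. -/
def endsMinus : Set Ends :=
  {ω | ∃ x : Vertex, 0 < x.1 ∧ x.1 ≤ 1 ∧ ConvergesToEnd (fun n => translate x (-(n : ℤ))) ω}

/-- The ends of positive type: the limits of the rays `x + 1, x + 2, …`, where `x` runs over
the dyadic rationals in `[1, 2)`. -/
def endsPlus : Set Ends :=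
  {ω | ∃ x : Vertex, 1 ≤ x.1 ∧ x.1 < 2 ∧ ConvergesToEnd (fun n => translate x (n : ℤ)) ω}

/-- The vertices of the skeleton: all those that belong neither to a ray of negative type
(these fill `(-∞, 0]`) nor to a ray of positive type (these fill `[2, ∞)`). -/
def skeletonVertices : Set Vertex := {x | 0 < x.1 ∧ x.1 < 2}

/-- The skeleton: what remains of the Schreier graph after all the rays have been removed. -/
def skeleton : SimpleGraph ↥skeletonVertices := schreier.induce skeletonVertices

/-- The skeleton vertices that belong to a finite set of vertices. -/
def skeletonPart (K : Finset Vertex) : Finset ↥skeletonVertices :=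
  K.preimage Subtype.val Subtype.val_injective.injOn

/-- The ends of the skeleton, as ends of the Schreier graph: `ω` is the image of the end `η` of
the skeleton if for each finite set `K` of vertices, the component of the skeleton without `K`
chosen by `η` lies in the component of the Schreier graph without `K` chosen by `ω`. -/
def endsSkeleton : Set Ends :=
  {ω | ∃ η ∈ SimpleGraph.end skeleton, ∀ K : Finset Vertex, ∀ y : ↥skeletonVertices,
    y ∈ SimpleGraph.ComponentCompl.supp (K := (skeletonPart K : Set ↥skeletonVertices))
      (η (Opposite.op (skeletonPart K))) → y.1 ∈ (ω.comp K).supp}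

/-! ### The space of ends is not empty -/

/-- The vertex `-n`. -/
def negVertex (n : ℕ) : Vertex := ⟨-n, -n, 0, by simp⟩

lemma negVertex_adj (n : ℕ) : schreier.Adj (negVertex n) (negVertex (n + 1)) := by
  refine ⟨fun h => ?_, elA, by simp [genSet], ?_⟩
  · have := congrArg Subtype.val h
    simp [negVertex] at this
  · apply Subtype.ext
    change genA _ = _
    rw [genA_apply]
    simp [negVertex]
    ring

lemma exists_negVertex_notMem (K : Finset Vertex) : ∃ n, ∀ m, n ≤ m → negVertex m ∉ K := by
  have hinj : Function.Injective negVertex := fun a b h => by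
    have := congrArg Subtype.val h
    simpa [negVertex] using this
  have hfin : (negVertex ⁻¹' (K : Set Vertex)).Finite := K.finite_toSet.preimage hinj.injOn
  obtain ⟨n, hn⟩ := hfin.bddAbove
  exact ⟨n + 1, fun m hm hmem => by
    have : m ≤ n := hn (show m ∈ _ from hmem)
    omega⟩

lemma negVertex_comp {K : Finset Vertex} {n : ℕ} (hn : ∀ m, n ≤ m → negVertex m ∉ K) (m : ℕ)
    (hm : n ≤ m) : schreier.componentComplMk (K := (K : Set Vertex)) (hn m hm) =
      schreier.componentComplMk (K := (K : Set Vertex)) (hn n le_rfl) := by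
  induction m, hm using Nat.le_induction with
  | base => rfl
  | succ m hm ih =>
    rw [← ih]
    exact (schreier.componentComplMk_eq_of_adj _ _ (negVertex_adj m)).symm

instance : Nonempty Ends := by
  choose n hn using exists_negVertex_notMem
  refine ⟨⟨fun K => schreier.componentComplMk (K := (K.unop : Set Vertex))
    (hn K.unop _ le_rfl), ?_⟩⟩
  intro L K f
  have hKL : (K.unop : Set Vertex) ⊆ (L.unop : Set Vertex) := CategoryTheory.le_of_op_hom f
  change SimpleGraph.ComponentCompl.hom hKL
      (schreier.componentComplMk (K := (L.unop : Set Vertex)) (hn L.unop _ le_rfl)) =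
    schreier.componentComplMk (K := (K.unop : Set Vertex)) (hn K.unop _ le_rfl)
  rw [← negVertex_comp (hn K.unop) (max (n K.unop) (n L.unop)) (le_max_left _ _)]
  have h := negVertex_comp (hn L.unop) (max (n K.unop) (n L.unop)) (le_max_right _ _)
  have h2 := congrArg (SimpleGraph.ComponentCompl.hom hKL) h
  exact h2.symm

/-! ## The random walk and the limit end field -/

/-- The positions `g_n = h_0 ⋯ h_{n-1}` of the walk issued from the identity, in terms of its
increments. -/
def positions (h : ℕ → FTilde) : ℕ → FTilde
  | 0 => 1
  | n + 1 => positions h n * h n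

lemma measurable_positions : Measurable positions := by
  refine measurable_pi_lambda _ fun n => ?_
  induction n with
  | zero => exact measurable_const
  | succ n ih =>
    have h : Measurable fun p : FTilde × FTilde => p.1 * p.2 := measurable_of_countable _
    exact h.comp (ih.prodMk (measurable_pi_apply n))

/-- The measure on the space of sample paths of the right random walk with step distribution `μ`
issued from the identity. -/
def pathMeasure (μ : PMF FTilde) : Measure (ℕ → FTilde) :=
  (Measure.infinitePi fun _ : ℕ => μ.toMeasure).map positions

instance (μ : PMF FTilde) : IsProbabilityMeasure (pathMeasure μ) :=
  Measure.isProbabilityMeasure_map measurable_positions.aemeasurable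

/-- The limit end of a sequence of vertices (an arbitrary end if the sequence diverges). -/
def limitEnd (x : ℕ → Vertex) : Ends := Classical.epsilon fun ω => ConvergesToEnd x ω

/-- The end field of a sample path: the value at `x` is the limit of `x.g_n`. -/
def endField (g : ℕ → FTilde) : Vertex → Ends := fun x => limitEnd fun n => act x (g n)

/-- The law of the limit end field, a measure on the configurations with values in the ends. -/
def limitMeasure (μ : PMF FTilde) : Measure (Vertex → Ends) := (pathMeasure μ).map endField

/-- The configurations on the Schreier graph with values in `A`. -/
def endFields (A : Set Ends) : Set (Vertex → Ends) := {φ | ∀ x, φ x ∈ A}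

/-- The barycentre of a (finitely supported) probability measure on `ℤ`. -/
def barycentre (p : PMF ℤ) : ℝ := ∑' k : ℤ, (p k).toReal * k

/-- The image of `μ` under a homomorphism to `ℤ`. -/
def imageMeasure (χ : FTilde →* Multiplicative ℤ) (μ : PMF FTilde) : PMF ℤ :=
  μ.map fun g => (χ g).toAdd

end

end ThompsonEnds

namespace ThompsonEnds

open ProbabilityTheory Topology

/-! ## The Markov operator on functions of a vertex -/

/-! The orbit of a vertex under the walk is a Markov chain on the dyadic rationals, and each group
element acts on them by a permutation. Counting measure is therefore invariant, though the chain
need not be reversible. Three mechanisms give the theorem.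

Transience. By invariance the Dirichlet form of a finitely supported `u` is the averaged shift
energy (`IsStepWeight.sum_shiftEnergy_eq`). The maps `x ↦ x / 2` and `x ↦ (x + 1) / 2` agree on `(0,
1)` with group elements and send `(0, 1)` into disjoint subintervals, so the energy bounds the mass
of `u` on `(0, 1)` (`sq_le_shiftEnergy_of_mem_Ioo`), and transitivity carries the bound to every
vertex. Applied to truncated Green functions this makes the expected number of visits to a vertex
finite (`IsStepWeight.sum_stepOp_pow_singleton_le`). Outside a finite set of vertices, a fixed group
element does not change the component of the complement of `K` (`eventually_sameComp_act`). A
transient path with finitely many kinds of steps thus converges to an end.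

Attracting sides. Near `-∞` and `+∞` the steps are translations, with mean `-α` and `-(α + β)`
respectively. If one of these drifts points outwards, a truncated exponential is superharmonic and
shows that the strip `[-M, M]`, which contains infinitely many vertices, is visited only finitely
often. The path then stays on one side, inside one coset of `ℤ`, and converges to the end of a ray.
A side whose drift is zero or inward cannot retain the path, because the corresponding integer walk
is unbounded (`ae_not_bddAbove_sum`). This settles the first three cases.

No attracting side. The retraction that collapses every ray to its starting point carries paths to
paths. If the retracted path returned to a vertex at a late time, the path would be trapped outside
the strip on one side, which unboundedness forbids (`IsStepBound.tendsto_retract`). The retracted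
path is therefore transient as well, and since late positions are joined to their retractions along
rays, the limit is an end of the skeleton. -/

/-- The action of a group element as a permutation of the vertices. -/
def actEquiv (g : FTilde) : Vertex ≃ Vertex where
  toFun z := act z g
  invFun z := act z g⁻¹
  left_inv z := by beta_reduce; rw [← act_mul, mul_inv_cancel, act_one]
  right_inv z := by beta_reduce; rw [← act_mul, inv_mul_cancel, act_one]

@[simp] lemma actEquiv_apply (g : FTilde) (z : Vertex) : actEquiv g z = act z g := rfl

/-- The Markov operator with weights `m` on the finite set `S` of steps. -/
def stepOp (S : Finset FTilde) (m : FTilde → ℝ) : Module.End ℝ (Vertex → ℝ) where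
  toFun φ z := ∑ h ∈ S, m h * φ (act z h)
  map_add' φ ψ := by
    ext z
    simp [mul_add, Finset.sum_add_distrib]
  map_smul' c φ := by
    ext z
    simp only [Pi.smul_apply, smul_eq_mul, RingHom.id_apply, Finset.mul_sum]
    exact Finset.sum_congr rfl fun h _ => by ring

lemma stepOp_apply (S : Finset FTilde) (m : FTilde → ℝ) (φ : Vertex → ℝ) (z : Vertex) :
    stepOp S m φ z = ∑ h ∈ S, m h * φ (act z h) := rfl

/-- A finite set of steps that generates the group as a semigroup, with positive weights of
total mass one. -/
structure IsStepWeight (S : Finset FTilde) (m : FTilde → ℝ) : Prop where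
  pos : ∀ h ∈ S, 0 < m h
  sum_eq_one : ∑ h ∈ S, m h = 1
  closure_eq_top : Subsemigroup.closure (S : Set FTilde) = ⊤

variable {S : Finset FTilde} {m : FTilde → ℝ}

lemma IsStepWeight.induction (hS : IsStepWeight S m) {p : FTilde → Prop}
    (mem : ∀ h ∈ S, p h) (mul : ∀ f g, p f → p g → p (f * g)) (g : FTilde) : p g := by
  have hg : g ∈ Subsemigroup.closure (S : Set FTilde) := by rw [hS.closure_eq_top]; trivial
  induction hg using Subsemigroup.closure_induction with
  | mem x hx => exact mem x hx
  | mul x y _ _ hx hy => exact mul x y hx hy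

lemma IsStepWeight.stepOp_mono (hS : IsStepWeight S m) {φ ψ : Vertex → ℝ} (h : φ ≤ ψ) :
    stepOp S m φ ≤ stepOp S m ψ := fun _ =>
  Finset.sum_le_sum fun g hg => mul_le_mul_of_nonneg_left (h _) (hS.pos g hg).le

lemma IsStepWeight.stepOp_pow_mono (hS : IsStepWeight S m) {φ ψ : Vertex → ℝ} (h : φ ≤ ψ)
    (n : ℕ) : (stepOp S m ^ n) φ ≤ (stepOp S m ^ n) ψ := by
  induction n with
  | zero => exact h
  | succ n ih => simpa only [pow_succ', Module.End.mul_apply] using hS.stepOp_mono ih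

lemma IsStepWeight.stepOp_pow_nonneg (hS : IsStepWeight S m) {φ : Vertex → ℝ} (h : 0 ≤ φ)
    (n : ℕ) : 0 ≤ (stepOp S m ^ n) φ := by
  simpa using hS.stepOp_pow_mono h n

lemma IsStepWeight.stepOp_pow_one (hS : IsStepWeight S m) (n : ℕ) : (stepOp S m ^ n) 1 = 1 := by
  induction n with
  | zero => rfl
  | succ n ih =>
    rw [pow_succ', Module.End.mul_apply, ih]
    ext z
    simp [stepOp_apply, hS.sum_eq_one]

/-! ### Bounded superharmonic functions -/

/-- Every group element is reached with positive probability, uniformly in the starting point. -/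
lemma IsStepWeight.exists_le_stepOp_pow (hS : IsStepWeight S m) (g : FTilde) :
    ∃ (k : ℕ) (c : ℝ), 0 < c ∧ ∀ ψ : Vertex → ℝ, 0 ≤ ψ → ∀ z,
      c * ψ (act z g) ≤ (stepOp S m ^ k) ψ z := by
  induction g using hS.induction with
  | mem h hh =>
    refine ⟨1, m h, hS.pos h hh, fun ψ hψ z => ?_⟩
    rw [pow_one, stepOp_apply]
    exact Finset.single_le_sum (f := fun h => m h * ψ (act z h))
      (fun g hg => mul_nonneg (hS.pos g hg).le (hψ _)) hh
  | mul f g hf hg =>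
    obtain ⟨k, c, hc, hk⟩ := hf
    obtain ⟨l, d, hd, hl⟩ := hg
    refine ⟨k + l, c * d, mul_pos hc hd, fun ψ hψ z => ?_⟩
    rw [pow_add, Module.End.mul_apply, act_mul, mul_assoc]
    exact (mul_le_mul_of_nonneg_left (hl ψ hψ _) hc.le).trans
      (hk _ (hS.stepOp_pow_nonneg hψ l) z)

/-- The sum telescopes with lag `k`: the first `k` values remain, minus `k` nonnegative ones. -/
lemma sum_range_sub_shift_le {a : ℕ → ℝ} (h0 : ∀ n, 0 ≤ a n) (h1 : ∀ n, a n ≤ 1) (k N : ℕ) :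
    ∑ n ∈ Finset.range N, (a n - a (n + k)) ≤ k := by
  have e1 := Finset.sum_range_add a N k
  have e2 := Finset.sum_range_add a k N
  rw [add_comm k N] at e2
  have h2 : ∑ n ∈ Finset.range k, a n ≤ k := by
    simpa using Finset.sum_le_sum fun n (_ : n ∈ Finset.range k) => h1 n
  have h3 : 0 ≤ ∑ n ∈ Finset.range k, a (N + n) := Finset.sum_nonneg fun n _ => h0 _
  simp only [Finset.sum_sub_distrib, add_comm _ k]
  linarith

/-- The expected number of visits to a set is bounded if a bounded superharmonic function is
maximal on it and uniformly smaller after the move by some fixed group element. -/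
lemma IsStepWeight.sum_stepOp_pow_indicator_le (hS : IsStepWeight S m) {φ : Vertex → ℝ}
    (h0 : 0 ≤ φ) (h1 : φ ≤ 1) (hφ : stepOp S m φ ≤ φ) {T : Set Vertex} (hT : ∀ z ∈ T, φ z = 1)
    {g : FTilde} {δ : ℝ} (hδ : 0 < δ) (hg : ∀ z ∈ T, φ (act z g) ≤ 1 - δ) :
    ∃ C : ℝ, ∀ x N, ∑ n ∈ Finset.range N, (stepOp S m ^ n) (T.indicator 1) x ≤ C := by
  obtain ⟨k, c, hc, hk⟩ := hS.exists_le_stepOp_pow g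
  have hanti : ∀ n, (stepOp S m ^ n) φ ≤ φ := by
    intro n
    induction n with
    | zero => exact le_rfl
    | succ n ih =>
      rw [pow_succ', Module.End.mul_apply]
      exact (hS.stepOp_mono ih).trans hφ
  -- On `T` the function `1 - φ` vanishes, but after `k` steps its mean is at least `c * δ`, because
  -- the move by `g` has weight at least `c`. Applying the powers of the operator and summing turns
  -- the loss into a lagged telescoping sum, whence the bound `k / (c * δ)`.
  have key : (stepOp S m ^ k) φ ≤ φ - (c * δ) • T.indicator 1 := by
    intro z
    by_cases hz : z ∈ T
    · have h2 := hk (1 - φ) (sub_nonneg.2 h1) z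
      rw [map_sub, hS.stepOp_pow_one] at h2
      have h3 := mul_le_mul_of_nonneg_left (hg z hz) hc.le
      simp only [Pi.sub_apply, Pi.one_apply, Pi.smul_apply, smul_eq_mul,
        Set.indicator_of_mem hz, hT z hz] at h2 ⊢
      linarith
    · simpa [hz] using hanti k z
  refine ⟨k / (c * δ), fun x N => ?_⟩
  rw [le_div_iff₀ (mul_pos hc hδ), mul_comm, Finset.mul_sum]
  refine le_trans (Finset.sum_le_sum fun n _ => ?_) (sum_range_sub_shift_le
    (a := fun n => (stepOp S m ^ n) φ x) (fun n => hS.stepOp_pow_nonneg h0 n x)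
    (fun n => (hanti n x).trans (h1 x)) k N)
  have h4 := hS.stepOp_pow_mono key n x
  rw [map_sub, map_smul, ← Module.End.mul_apply, ← pow_add] at h4
  simp only [Pi.sub_apply, Pi.smul_apply, smul_eq_mul] at h4
  linarith

/-! ### Energy -/

/-- The squared norm of the difference between a function and its translate. -/
noncomputable def shiftEnergy (g : FTilde) (u : Vertex → ℝ) : ℝ :=
  ∑' z, (u z - u (act z g)) ^ 2

lemma finite_support_comp_act {u : Vertex → ℝ} (hu : u.support.Finite) (g : FTilde) :
    (Function.support fun z => u (act z g)).Finite :=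
  hu.preimage (actEquiv g).injective.injOn

lemma summable_of_support_subset {u v : Vertex → ℝ} (hu : u.support.Finite)
    (h : ∀ z, u z = 0 → v z = 0) : Summable v :=
  summable_of_hasFiniteSupport (hu.subset fun z hz h0 => hz (h z h0))

lemma summable_shift_sq {u : Vertex → ℝ} (hu : u.support.Finite) (f g : FTilde) :
    Summable fun z => (u (act z f) - u (act z g)) ^ 2 := by
  refine summable_of_hasFiniteSupport
    (((finite_support_comp_act hu f).union (finite_support_comp_act hu g)).subset fun z hz => ?_)
  by_contra h
  simp only [Set.mem_union, Function.mem_support, not_or, not_not] at h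
  simp [h.1, h.2] at hz

lemma tsum_comp_act (f : Vertex → ℝ) (g : FTilde) : ∑' z, f (act z g) = ∑' z, f z :=
  (actEquiv g).tsum_eq f

lemma shiftEnergy_nonneg (g : FTilde) (u : Vertex → ℝ) : 0 ≤ shiftEnergy g u :=
  tsum_nonneg fun _ => sq_nonneg _

lemma sq_sub_le_shiftEnergy {u : Vertex → ℝ} (hu : u.support.Finite) (g : FTilde) (z : Vertex) :
    (u z - u (act z g)) ^ 2 ≤ shiftEnergy g u :=
  (summable_shift_sq hu 1 g).le_tsum z fun _ _ => sq_nonneg _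

/-- From `(a + b)² ≤ 2a² + 2b²`, with the second difference reindexed by the permutation `f`. -/
lemma shiftEnergy_mul_le {u : Vertex → ℝ} (hu : u.support.Finite) (f g : FTilde) :
    shiftEnergy (f * g) u ≤ 2 * shiftEnergy f u + 2 * shiftEnergy g u := by
  have h1 : Summable fun z => (u z - u (act z f)) ^ 2 := summable_shift_sq hu 1 f
  have h2 := summable_shift_sq hu f (f * g)
  have e : shiftEnergy g u = ∑' z, (u (act z f) - u (act z (f * g))) ^ 2 :=
    (tsum_comp_act (fun z => (u z - u (act z g)) ^ 2) f).symm
  rw [e, shiftEnergy, shiftEnergy, ← tsum_mul_left, ← tsum_mul_left,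
    ← Summable.tsum_add (h1.mul_left 2) (h2.mul_left 2)]
  refine Summable.tsum_le_tsum (fun z => ?_) (summable_shift_sq hu 1 (f * g))
    ((h1.mul_left 2).add (h2.mul_left 2))
  nlinarith [sq_nonneg ((u z - u (act z f)) - (u (act z f) - u (act z (f * g))))]

/-- Since `S` generates the group as a semigroup, the Dirichlet form of the walk dominates the
energy along any group element, including the contractions used below. -/
lemma IsStepWeight.exists_shiftEnergy_le (hS : IsStepWeight S m) (g : FTilde) :
    ∃ C : ℝ, 0 ≤ C ∧ ∀ u : Vertex → ℝ, u.support.Finite →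
      shiftEnergy g u ≤ C * ∑ h ∈ S, m h * shiftEnergy h u := by
  induction g using hS.induction with
  | mem h hh =>
    refine ⟨(m h)⁻¹, (inv_pos.2 (hS.pos h hh)).le, fun u _ => ?_⟩
    rw [inv_mul_eq_div, le_div_iff₀ (hS.pos h hh), mul_comm]
    exact Finset.single_le_sum (f := fun h => m h * shiftEnergy h u)
      (fun g hg => mul_nonneg (hS.pos g hg).le (shiftEnergy_nonneg _ _)) hh
  | mul f g hf hg =>
    obtain ⟨C, hC, h1⟩ := hf
    obtain ⟨D, hD, h2⟩ := hg
    refine ⟨2 * C + 2 * D, by positivity, fun u hu => ?_⟩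
    have := shiftEnergy_mul_le hu f g
    have := h1 u hu
    have := h2 u hu
    linarith

/-- Expanding the square, the sums of `u²` and of its translate agree because counting measure is
invariant. No symmetry of the weights is needed. -/
lemma shiftEnergy_eq {u : Vertex → ℝ} (hu : u.support.Finite) (g : FTilde) :
    shiftEnergy g u = 2 * ∑' z, u z * (u z - u (act z g)) := by
  have s1 : Summable fun z => u z ^ 2 := summable_of_support_subset hu fun z h => by simp [h]
  have s2 : Summable fun z => u (act z g) ^ 2 :=
    summable_of_support_subset (finite_support_comp_act hu g) fun z h => by simp [h]
  have s3 : Summable fun z => u z * (u z - u (act z g)) :=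
    summable_of_support_subset hu fun z h => by simp [h]
  have e := tsum_comp_act (fun z => u z ^ 2) g
  have : ∀ z, (u z - u (act z g)) ^ 2 =
      2 * (u z * (u z - u (act z g))) + (u (act z g) ^ 2 - u z ^ 2) := fun z => by ring
  rw [shiftEnergy, tsum_congr this, (s3.mul_left 2).tsum_add (s2.sub s1), tsum_mul_left,
    s2.tsum_sub s1, e, sub_self, add_zero]

lemma IsStepWeight.sum_shiftEnergy_eq (hS : IsStepWeight S m) {u : Vertex → ℝ}
    (hu : u.support.Finite) :
    ∑ h ∈ S, m h * shiftEnergy h u = 2 * ∑' z, u z * (u z - stepOp S m u z) := by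
  have s : ∀ h ∈ S, Summable fun z => m h * (u z * (u z - u (act z h))) := fun h _ =>
    summable_of_support_subset hu fun z h => by simp [h]
  have e : ∀ z, u z * (u z - stepOp S m u z) =
      ∑ h ∈ S, m h * (u z * (u z - u (act z h))) := by
    intro z
    rw [stepOp_apply]
    nth_rewrite 2 [← one_mul (u z)]
    rw [← hS.sum_eq_one, Finset.sum_mul, ← Finset.sum_sub_distrib, Finset.mul_sum]
    exact Finset.sum_congr rfl fun h _ => by ring
  rw [tsum_congr e, Summable.tsum_finsetSum s, Finset.mul_sum]
  refine Finset.sum_congr rfl fun h _ => ?_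
  rw [shiftEnergy_eq hu, tsum_mul_left]
  ring

/-! ### The paradoxical pair of maps -/

lemma toFun_elA (x : ℝ) : toFun elA x = x - 1 := rfl

lemma toFun_elA_inv (x : ℝ) : toFun elA⁻¹ x = x + 1 := rfl

lemma toFun_elB (x : ℝ) :
    toFun elB x = if x ≤ 0 then x else if x ≤ 2 then x / 2 else x - 1 := rfl

lemma toFun_elB_inv (x : ℝ) :
    toFun elB⁻¹ x = if x ≤ 0 then x else if x ≤ 1 then 2 * x else x + 1 := rfl

lemma toFun_elB_mem_iff (x : ℝ) : toFun elB x ∈ Set.Ioo 0 (1 / 2) ↔ x ∈ Set.Ioo (0 : ℝ) 1 := by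
  rw [toFun_elB, Set.mem_Ioo, Set.mem_Ioo]
  split_ifs <;> constructor <;> rintro ⟨_, _⟩ <;> constructor <;> linarith

lemma toFun_elA_inv_mul_elB_mem_iff (x : ℝ) :
    toFun (elA⁻¹ * elB) x ∈ Set.Ioo (1 / 2) 1 ↔ x ∈ Set.Ioo (0 : ℝ) 1 := by
  rw [toFun_mul, toFun_elA_inv, toFun_elB, Set.mem_Ioo, Set.mem_Ioo]
  split_ifs <;> constructor <;> rintro ⟨_, _⟩ <;> constructor <;> linarith

/-- The mass of a function on the unit interval is controlled by the energies of the two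
contractions `x ↦ x / 2` and `x ↦ (x + 1) / 2`, because these have disjoint images. -/
lemma sq_le_shiftEnergy_of_mem_Ioo {u : Vertex → ℝ} (hu : u.support.Finite) {y : Vertex}
    (hy : y.1 ∈ Set.Ioo (0 : ℝ) 1) :
    u y ^ 2 ≤ 6 * (shiftEnergy elB u + shiftEnergy (elA⁻¹ * elB) u) := by
  classical
  let ψ : Set ℝ → Vertex → ℝ := fun I z => if z.1 ∈ I then u z ^ 2 else 0
  have hψ : ∀ I, Summable (ψ I) := fun I =>
    summable_of_support_subset hu fun z h => by simp [ψ, h]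
  have hψ' : ∀ I g, Summable fun z => ψ I (act z g) := fun I g =>
    (actEquiv g).summable_iff.2 (hψ I)
  have hsplit : ∑' z, ψ (Set.Ioo 0 (1 / 2)) z + ∑' z, ψ (Set.Ioo (1 / 2) 1) z ≤
      ∑' z, ψ (Set.Ioo 0 1) z := by
    rw [← (hψ _).tsum_add (hψ _)]
    refine Summable.tsum_le_tsum (fun z => ?_) ((hψ _).add (hψ _)) (hψ _)
    have := sq_nonneg (u z)
    simp only [ψ, Set.mem_Ioo]
    split_ifs with h1 h2 h3 h3 h4 h5 h5 <;> first | linarith | (exfalso; grind)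
  -- The point is that `3 / 2 < 2`: adding the inequalities for the two disjoint images bounds twice
  -- the mass on `(0, 1)` by `3 / 2` of it plus three times the two energies, which gives the
  -- constant `6`.
  have hcmp : ∀ g I, (∀ x : ℝ, toFun g x ∈ I ↔ x ∈ Set.Ioo (0 : ℝ) 1) →
      ∑' z, ψ (Set.Ioo 0 1) z ≤ 3 / 2 * ∑' z, ψ I z + 3 * shiftEnergy g u := by
    intro g I hI
    have s2 : Summable fun z => (u z - u (act z g)) ^ 2 := summable_shift_sq hu 1 g
    rw [← tsum_comp_act (ψ I) g, shiftEnergy, ← tsum_mul_left, ← tsum_mul_left,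
      ← ((hψ' I g).mul_left _).tsum_add (s2.mul_left _)]
    refine Summable.tsum_le_tsum (fun z => ?_) (hψ _) (((hψ' I g).mul_left _).add (s2.mul_left _))
    have hz : (act z g).1 ∈ I ↔ z.1 ∈ Set.Ioo (0 : ℝ) 1 := hI z.1
    simp only [ψ, hz]
    split_ifs
    -- With `v` the translated value and `w` the difference, `3/2 v² + 3 w² - (v + w)² = (v - 2w)² /
    -- 2`.
    · nlinarith [sq_nonneg (u (act z g) - 2 * (u z - u (act z g)))]
    · nlinarith [sq_nonneg (u z - u (act z g))]
  have h1 := hcmp _ _ toFun_elB_mem_iff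
  have h2 := hcmp _ _ toFun_elA_inv_mul_elB_mem_iff
  have h3 : u y ^ 2 ≤ ∑' z, ψ (Set.Ioo 0 1) z := by
    have := (hψ (Set.Ioo 0 1)).le_tsum y fun z _ => by simp only [ψ]; split_ifs <;> positivity
    rwa [show ψ (Set.Ioo 0 1) y = u y ^ 2 from if_pos hy] at this
  linarith

/-! ### Transitivity of the action -/

lemma act_elA_pow (n : ℕ) (x : Vertex) : act x (elA ^ n) = translate x (-(n : ℤ)) := by
  induction n with
  | zero => apply Subtype.ext; simp [translate, act_one]
  | succ n ih =>
    rw [pow_succ, act_mul, ih]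
    apply Subtype.ext
    change toFun elA _ = _
    rw [toFun_elA]
    simp only [translate]
    push_cast
    ring

lemma exists_forall_act_eq_translate (c : ℤ) : ∃ g, ∀ x, act x g = translate x c := by
  obtain ⟨n, rfl | rfl⟩ := c.eq_nat_or_neg
  · refine ⟨(elA ^ n)⁻¹, fun x => ?_⟩
    have h : act (translate x n) (elA ^ n) = x := by
      rw [act_elA_pow]
      apply Subtype.ext
      simp [translate]
    calc act x (elA ^ n)⁻¹ = act (act (translate x n) (elA ^ n)) (elA ^ n)⁻¹ := by rw [h]
      _ = translate x n := by rw [← act_mul, mul_inv_cancel, act_one]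
  · exact ⟨elA ^ n, act_elA_pow n⟩

/-- The vertex `1 / 2`. -/
noncomputable def halfVertex : Vertex := ⟨1 / 2, 1, 1, by norm_num⟩

/-- Induction on the exponent of the denominator: an integer translation brings the point into `(0,
1]`, where `elB⁻¹` doubles it and lowers the exponent by one. Integers are translated to `1` and
then halved by `elB`. -/
lemma exists_act_eq_halfVertex (x : Vertex) : ∃ g, act x g = halfVertex := by
  obtain ⟨x, k, n, rfl⟩ := x
  induction n generalizing k with
  | zero =>
    obtain ⟨g, hg⟩ := exists_forall_act_eq_translate (1 - k)
    refine ⟨g * elB, ?_⟩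
    rw [act_mul, hg]
    apply Subtype.ext
    change toFun elB _ = _
    rw [toFun_elB]
    simp [translate, halfVertex]
  | succ n ih =>
    set x : Vertex := ⟨(k : ℝ) / 2 ^ (n + 1), k, n + 1, rfl⟩
    obtain ⟨g, hg⟩ := exists_forall_act_eq_translate (1 - ⌈x.1⌉)
    -- This is the numerator over `2 ^ n` of the doubled translate `2 * (x + 1 - ⌈x⌉)`.
    obtain ⟨f, hf⟩ := ih (k + (1 - ⌈x.1⌉) * 2 ^ (n + 1))
    refine ⟨g * elB⁻¹ * f, ?_⟩
    rw [act_mul, act_mul, hg, ← hf]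
    congr 1
    apply Subtype.ext
    change toFun elB⁻¹ (x.1 + _) = _
    have h1 := Int.le_ceil x.1
    have h2 := Int.ceil_lt_add_one x.1
    rw [toFun_elB_inv]
    push_cast
    rw [if_neg (by linarith), if_pos (by linarith)]
    simp only [x]
    field_simp
    ring

/-! ### The Green function -/

lemma finite_support_stepOp {u : Vertex → ℝ} (hu : u.support.Finite) :
    (stepOp S m u).support.Finite := by
  refine (S.finite_toSet.biUnion fun h _ => finite_support_comp_act hu h).subset fun z hz => ?_
  obtain ⟨h, hh, hne⟩ := Finset.exists_ne_zero_of_sum_ne_zero hz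
  exact Set.mem_biUnion hh (right_ne_zero_of_mul hne)

lemma finite_support_stepOp_pow {u : Vertex → ℝ} (hu : u.support.Finite) (n : ℕ) :
    ((stepOp S m ^ n) u).support.Finite := by
  induction n with
  | zero => exact hu
  | succ n ih =>
    rw [pow_succ', Module.End.mul_apply]
    exact finite_support_stepOp ih

/-- The expected number of visits to `y` is finite. -/
theorem IsStepWeight.sum_stepOp_pow_singleton_le (hS : IsStepWeight S m) (x y : Vertex) :
    ∃ C : ℝ, ∀ N, ∑ n ∈ Finset.range N, (stepOp S m ^ n) (({y} : Set Vertex).indicator 1) x ≤ C := by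
  set δ : Vertex → ℝ := ({y} : Set Vertex).indicator 1
  have hδ0 : 0 ≤ δ := Set.indicator_nonneg fun _ _ => zero_le_one
  have hδ : δ.support.Finite := (Set.finite_singleton y).subset Set.support_indicator_subset
  set u : ℕ → Vertex → ℝ := fun N => ∑ n ∈ Finset.range N, (stepOp S m ^ n) δ
  have hu0 : ∀ N, 0 ≤ u N := fun N => Finset.sum_nonneg fun n _ => hS.stepOp_pow_nonneg hδ0 n
  have hu : ∀ N, (u N).support.Finite := by
    intro N
    refine ((Finset.range N).finite_toSet.biUnion fun n _ =>
      finite_support_stepOp_pow (S := S) (m := m) hδ n).subset fun z hz => ?_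
    simp only [Function.mem_support, u, Finset.sum_apply] at hz
    obtain ⟨n, hn, hne⟩ := Finset.exists_ne_zero_of_sum_ne_zero hz
    exact Set.mem_biUnion hn hne
  have hdiff : ∀ N, u N - stepOp S m (u N) = δ - (stepOp S m ^ N) δ := by
    intro N
    simp only [u, map_sum]
    rw [← Finset.sum_sub_distrib]
    have := Finset.sum_range_sub' (fun n => (stepOp S m ^ n) δ) N
    simpa only [pow_succ', Module.End.mul_apply, pow_zero, Module.End.one_apply] using this
  -- Pairing `u N` with `u N - stepOp S m (u N) ≤ δ` leaves only the value at `y`.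
  have henergy : ∀ N, ∑ h ∈ S, m h * shiftEnergy h (u N) ≤ 2 * u N y := by
    intro N
    rw [hS.sum_shiftEnergy_eq (hu N)]
    refine mul_le_mul_of_nonneg_left ?_ zero_le_two
    have e : u N y = ∑' z, u N z * δ z := by
      rw [tsum_eq_single y fun z hz => by simp [δ, hz]]
      simp [δ]
    rw [e]
    refine Summable.tsum_le_tsum (fun z => ?_)
      (summable_of_support_subset (hu N) fun z h => by simp [h])
      (summable_of_support_subset (hu N) fun z h => by simp [h])
    refine mul_le_mul_of_nonneg_left ?_ (hu0 N z)
    have := congrFun (hdiff N) z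
    simp only [Pi.sub_apply] at this
    rw [this]
    exact sub_le_self _ (hS.stepOp_pow_nonneg hδ0 N z)
  have hE : ∀ g, ∃ C : ℝ, 0 ≤ C ∧ ∀ N, shiftEnergy g (u N) ≤ C * u N y := by
    intro g
    obtain ⟨C, hC, h⟩ := hS.exists_shiftEnergy_le g
    refine ⟨C * 2, by positivity, fun N => (h _ (hu N)).trans ?_⟩
    rw [mul_assoc]
    exact mul_le_mul_of_nonneg_left (henergy N) hC
  -- The value at `1 / 2` is controlled by the contractions, and the difference between `z` and `1 /
  -- 2` by the energy along a group element joining them; `12` is `2 * 6`.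
  have hbound : ∀ z, ∃ C : ℝ, 0 ≤ C ∧ ∀ N, u N z ^ 2 ≤ C * u N y := by
    intro z
    obtain ⟨g, hg⟩ := exists_act_eq_halfVertex z
    obtain ⟨C₁, hC₁, h₁⟩ := hE elB
    obtain ⟨C₂, hC₂, h₂⟩ := hE (elA⁻¹ * elB)
    obtain ⟨C₃, hC₃, h₃⟩ := hE g
    refine ⟨12 * (C₁ + C₂) + 2 * C₃, by positivity, fun N => ?_⟩
    have k₁ := sq_le_shiftEnergy_of_mem_Ioo (hu N) (y := halfVertex)
      (by simp only [halfVertex, Set.mem_Ioo]; norm_num)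
    have k₂ := sq_sub_le_shiftEnergy (hu N) g z
    rw [hg] at k₂
    nlinarith [h₁ N, h₂ N, h₃ N, sq_nonneg (u N z - 2 * u N halfVertex)]
  obtain ⟨C, hC, h⟩ := hbound y
  obtain ⟨D, hD, h'⟩ := hbound x
  refine ⟨1 + D * C, fun N => ?_⟩
  -- At `z = y` the quadratic bound improves itself: `t² ≤ C t` forces `t ≤ C`, uniformly in `N`.
  have hy : u N y ≤ C := by
    by_contra hlt
    push Not at hlt
    nlinarith [h N, hu0 N y]
  have hx := (h' N).trans (mul_le_mul_of_nonneg_left hy hD)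
  have e : ∑ n ∈ Finset.range N, (stepOp S m ^ n) δ x = u N x := by simp [u]
  rw [e]
  nlinarith [sq_nonneg (u N x - 1)]

/-! ## Convergence to ends -/

/-- Two vertices lie in the same component of the complement of `K`. -/
def SameComp {V : Type*} (G : SimpleGraph V) (K : Set V) (x y : V) : Prop :=
  ∃ C : G.ComponentCompl K, x ∈ C.supp ∧ y ∈ C.supp

/-! ### Connectivity in the complement of a set of vertices -/

section SameComp

variable {V : Type*} {G : SimpleGraph V} {K : Set V} {x y z : V}

lemma eq_of_mem_supp {C D : G.ComponentCompl K} (hC : x ∈ C.supp) (hD : x ∈ D.supp) : C = D := by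
  obtain ⟨_, h1⟩ := hC
  obtain ⟨_, h2⟩ := hD
  exact h1.symm.trans h2

lemma SameComp.refl (hx : x ∉ K) : SameComp G K x x :=
  ⟨G.componentComplMk hx, ⟨hx, rfl⟩, ⟨hx, rfl⟩⟩

lemma SameComp.symm (h : SameComp G K x y) : SameComp G K y x :=
  let ⟨C, hx, hy⟩ := h
  ⟨C, hy, hx⟩

lemma SameComp.trans (h : SameComp G K x y) (h' : SameComp G K y z) : SameComp G K x z := by
  obtain ⟨C, hx, hy⟩ := h
  obtain ⟨D, hy', hz⟩ := h'
  obtain rfl := eq_of_mem_supp hy hy'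
  exact ⟨C, hx, hz⟩

lemma SameComp.of_adj (hx : x ∉ K) (hy : y ∉ K) (h : G.Adj x y) : SameComp G K x y :=
  ⟨G.componentComplMk hx, ⟨hx, rfl⟩, hy, (G.componentComplMk_eq_of_adj hx hy h).symm⟩

lemma SameComp.mem_supp (h : SameComp G K x y) {C : G.ComponentCompl K} (hx : x ∈ C.supp) :
    y ∈ C.supp := by
  obtain ⟨D, hx', hy⟩ := h
  rwa [eq_of_mem_supp hx hx']

lemma SameComp.of_mem {C : G.ComponentCompl K} (hx : x ∈ C.supp) (hy : y ∈ C.supp) :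
    SameComp G K x y := ⟨C, hx, hy⟩

lemma SameComp.componentComplMk_eq (h : SameComp G K x y) (hx : x ∉ K) (hy : y ∉ K) :
    G.componentComplMk hx = G.componentComplMk hy := by
  obtain ⟨C, ⟨_, h1⟩, ⟨_, h2⟩⟩ := h
  exact h1.trans h2.symm

end SameComp

/-- Induction over the words in the generators. -/
lemma FTilde.induction {p : FTilde → Prop} (hA : p elA) (hB : p elB) (one : p 1)
    (mul : ∀ f g, p f → p g → p (f * g)) (inv : ∀ g, p g → p g⁻¹) (g : FTilde) : p g := by
  obtain ⟨g, hg⟩ := g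
  induction hg using Subgroup.closure_induction with
  | mem x hx =>
    rcases hx with rfl | rfl
    · exact hA
    · exact hB
  | one => exact one
  | mul f g _ _ hf hg => exact mul _ _ hg hf
  | inv f _ hf => exact inv _ hf

lemma tendsto_act_cofinite (g : FTilde) : Tendsto (fun z => act z g) cofinite cofinite :=
  (actEquiv g).injective.tendsto_cofinite

/-- A generator moves a vertex along an edge or fixes it, and only finitely many vertices lie in `K`
or are sent into `K`. Products and inverses inherit the property because permutations preserve the
cofinite filter. -/
lemma eventually_sameComp_act (K : Finset Vertex) (g : FTilde) :
    ∀ᶠ z in cofinite, SameComp schreier (K : Set Vertex) z (act z g) := by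
  have hK : ∀ᶠ z in cofinite, z ∉ (K : Set Vertex) := K.finite_toSet.compl_mem_cofinite
  have hgen : ∀ g ∈ genSet, ∀ᶠ z in cofinite, SameComp schreier (K : Set Vertex) z (act z g) := by
    intro g hg
    filter_upwards [hK, (tendsto_act_cofinite g).eventually hK] with z h1 h2
    by_cases h : z = act z g
    · rw [← h]
      exact .refl h1
    · exact .of_adj h1 h2 ⟨h, g, hg, rfl⟩
  induction g using FTilde.induction with
  | hA => exact hgen _ (by simp [genSet])
  | hB => exact hgen _ (by simp [genSet])
  | one => exact hK.mono fun z hz => .refl hz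
  | mul f g hf hg =>
    filter_upwards [hf, (tendsto_act_cofinite f).eventually hg] with z h1 h2
    exact h1.trans h2
  | inv g hg =>
    filter_upwards [(tendsto_act_cofinite g⁻¹).eventually hg] with z h
    rw [← act_mul, inv_mul_cancel, act_one] at h
    exact h.symm

lemma Ends.supp_mono (ω : Ends) {K L : Finset Vertex} (h : K ⊆ L) :
    (ω.comp L).supp ⊆ (ω.comp K).supp := by
  have hKL : (K : Set Vertex) ⊆ L := by exact_mod_cast h
  have e : SimpleGraph.ComponentCompl.hom hKL (ω.comp L) = ω.comp K :=
    ω.2 (CategoryTheory.homOfLE h).op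
  rw [← e]
  exact SimpleGraph.ComponentCompl.subset_hom (ω.comp L) hKL

/-- A sequence converges to an end if for each finite set it eventually stays in one component of
the complement. -/
lemma exists_convergesToEnd_of_eventually_mem {x : ℕ → Vertex}
    (h : ∀ K : Finset Vertex, ∃ C : schreier.ComponentCompl (K : Set Vertex),
      ∀ᶠ n in atTop, x n ∈ C.supp) : ∃ ω, ConvergesToEnd x ω := by
  choose C hC using h
  refine ⟨⟨fun K => C K.unop, ?_⟩, hC⟩
  intro L K f
  have hKL : (K.unop : Set Vertex) ⊆ (L.unop : Set Vertex) := CategoryTheory.le_of_op_hom f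
  obtain ⟨n, hn, hn'⟩ := ((hC L.unop).and (hC K.unop)).exists
  exact eq_of_mem_supp (SimpleGraph.ComponentCompl.subset_hom (C L.unop) hKL hn) hn'

/-- A sequence that is eventually connected outside of each finite set converges to an end. -/
lemma exists_convergesToEnd {x : ℕ → Vertex}
    (h : ∀ K : Finset Vertex, ∀ᶠ n in atTop, SameComp schreier (K : Set Vertex) (x n) (x (n + 1))) :
    ∃ ω, ConvergesToEnd x ω := by
  refine exists_convergesToEnd_of_eventually_mem fun K => ?_
  obtain ⟨N, hN⟩ := eventually_atTop.1 (h K)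
  obtain ⟨C, hC, -⟩ := hN N le_rfl
  refine ⟨C, eventually_atTop.2 ⟨N, fun n hn => ?_⟩⟩
  induction n, hn using Nat.le_induction with
  | base => exact hC
  | succ n hn ih => exact (hN n hn).mem_supp ih

/-- A sequence that leaves all finite sets and moves by finitely many group elements converges to
an end. -/
lemma exists_convergesToEnd_of_steps {x : ℕ → Vertex} (hx : Tendsto x atTop cofinite)
    (S : Finset FTilde) (hS : ∀ n, ∃ g ∈ S, x (n + 1) = act (x n) g) :
    ∃ ω, ConvergesToEnd x ω := by
  refine exists_convergesToEnd fun K => ?_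
  have h : ∀ᶠ z in cofinite, ∀ g ∈ S, SameComp schreier (K : Set Vertex) z (act z g) :=
    (Filter.eventually_all_finset S).2 fun g _ => eventually_sameComp_act K g
  filter_upwards [hx.eventually h] with n hn
  obtain ⟨g, hg, e⟩ := hS n
  rw [e]
  exact hn g hg

lemma ConvergesToEnd.comp {x : ℕ → Vertex} {ω : Ends} (h : ConvergesToEnd x ω) {k : ℕ → ℕ}
    (hk : Tendsto k atTop atTop) : ConvergesToEnd (x ∘ k) ω := fun K => hk.eventually (h K)

lemma ConvergesToEnd.congr {x y : ℕ → Vertex} {ω : Ends} (h : ConvergesToEnd x ω)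
    (hxy : x =ᶠ[atTop] y) : ConvergesToEnd y ω := fun K => by
  filter_upwards [h K, hxy] with n h1 h2
  rwa [← h2]

/-! ### Rays -/

lemma translate_translate (x : Vertex) (a b : ℤ) :
    translate (translate x a) b = translate x (a + b) := by
  apply Subtype.ext
  simp only [translate]
  push_cast
  ring

lemma translate_zero (x : Vertex) : translate x 0 = x := by
  apply Subtype.ext
  simp [translate]

lemma translate_injective (x : Vertex) : Function.Injective (translate x) := by
  intro a b h
  have := congrArg Subtype.val h
  simpa [translate] using this

lemma act_elA (x : Vertex) : act x elA = translate x (-1) := by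
  apply Subtype.ext
  change toFun elA x.1 = _
  rw [toFun_elA, translate]
  push_cast
  ring

lemma act_elA_inv (x : Vertex) : act x elA⁻¹ = translate x 1 := by
  apply Subtype.ext
  change toFun elA⁻¹ x.1 = _
  rw [toFun_elA_inv, translate]
  push_cast
  rfl

lemma exists_genSet_act_eq_translate {ε : ℤ} (hε : ε = 1 ∨ ε = -1) :
    ∃ g ∈ genSet, ∀ x, act x g = translate x ε := by
  rcases hε with rfl | rfl
  · exact ⟨elA⁻¹, by simp [genSet], act_elA_inv⟩
  · exact ⟨elA, by simp [genSet], act_elA⟩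

/-- A sequence which escapes to infinity along a ray of translates has the same limit as the
ray. -/
lemma ConvergesToEnd.ray {x : ℕ → Vertex} {ω : Ends} (h : ConvergesToEnd x ω)
    (hx : Tendsto x atTop cofinite) {ε : ℤ} (hε : ε = 1 ∨ ε = -1) {y : Vertex} {c : ℤ}
    (hy : ∀ᶠ n in atTop, ∃ j : ℤ, c ≤ j ∧ x n = translate y (ε * j)) :
    ConvergesToEnd (fun n => translate y (ε * (n : ℤ))) ω := by
  obtain ⟨g, -, hg⟩ := exists_genSet_act_eq_translate hε
  have hε0 : ε ≠ 0 := by rcases hε with rfl | rfl <;> norm_num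
  have hinj : Function.Injective fun j : ℤ => translate y (ε * j) :=
    (translate_injective y).comp (mul_right_injective₀ hε0)
  have hinj' : Function.Injective fun n : ℕ => translate y (ε * (n : ℤ)) :=
    hinj.comp Nat.cast_injective
  obtain ⟨ω', hω'⟩ := exists_convergesToEnd_of_steps (x := fun n : ℕ => translate y (ε * (n : ℤ)))
    (Nat.cofinite_eq_atTop ▸ hinj'.tendsto_cofinite) {g} fun n => ⟨g, by simp, by
      rw [hg, translate_translate]
      congr 1
      push_cast
      ring⟩
  obtain ⟨N, hN⟩ := eventually_atTop.1 hy
  choose! j hj hxj using hN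
  -- The indices are bounded below by `c`, and those in `[c, b]` give finitely many vertices, which
  -- the sequence eventually avoids.
  have hlim : Tendsto (fun n => (j n).toNat) atTop atTop := by
    refine tendsto_atTop.2 fun b => ?_
    have hfin : ((fun j : ℤ => translate y (ε * j)) '' Set.Icc c b).Finite :=
      (Set.finite_Icc c b).image _
    filter_upwards [eventually_ge_atTop N, hx.eventually hfin.compl_mem_cofinite] with n hn hnot
    by_contra hlt
    exact hnot ⟨j n, ⟨hj n hn, by omega⟩, (hxj n hn).symm⟩
  have hω : ConvergesToEnd x ω' := by
    refine (hω'.comp hlim).congr ?_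
    -- `toNat` being at least `1` rules out truncation of a negative index.
    filter_upwards [eventually_ge_atTop N, hlim.eventually_ge_atTop 1] with n hn h1
    rw [hxj n hn, Function.comp_apply]
    congr 2
    omega
  rw [h.unique hω]
  exact hω'

/-- A transient sequence that is bounded above and eventually stays in one coset of `ℤ` can only run
to `-∞` along it. The ray starts at the representative of the coset in `(0, 1]`. -/
lemma mem_endsMinus_of_le {x : ℕ → Vertex} {ω : Ends} (h : ConvergesToEnd x ω)
    (hx : Tendsto x atTop cofinite) {z : Vertex} {c : ℝ}
    (hz : ∀ᶠ n in atTop, (x n).1 ≤ c ∧ ∃ j : ℤ, x n = translate z j) : ω ∈ endsMinus := by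
  have h1 := Int.le_ceil z.1
  have h2 := Int.ceil_lt_add_one z.1
  refine ⟨translate z (1 - ⌈z.1⌉), ?_, ?_, ?_⟩
  · simp only [translate]
    push_cast
    linarith
  · simp only [translate]
    push_cast
    linarith
  · have := h.ray hx (ε := -1) (Or.inr rfl) (y := translate z (1 - ⌈z.1⌉)) (c := -⌈c⌉) ?_
    · simpa using this
    filter_upwards [hz] with n ⟨hn, j, hj⟩
    refine ⟨1 - ⌈z.1⌉ - j, ?_, ?_⟩
    · rw [hj] at hn
      simp only [translate] at hn
      have h3 : (-(1 - ⌈z.1⌉ - j) : ℤ) < (⌈c⌉ + 1 : ℤ) := by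
        have := Int.le_ceil c
        rify
        linarith
      linarith
    · rw [hj, translate_translate]
      congr 1
      ring

/-- Mirror image of `mem_endsMinus_of_le`, with the representative of the coset in `[1, 2)`. -/
lemma mem_endsPlus_of_le {x : ℕ → Vertex} {ω : Ends} (h : ConvergesToEnd x ω)
    (hx : Tendsto x atTop cofinite) {z : Vertex} {c : ℝ}
    (hz : ∀ᶠ n in atTop, c ≤ (x n).1 ∧ ∃ j : ℤ, x n = translate z j) : ω ∈ endsPlus := by
  have h1 := Int.floor_le z.1
  have h2 := Int.lt_floor_add_one z.1
  refine ⟨translate z (1 - ⌊z.1⌋), ?_, ?_, ?_⟩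
  · simp only [translate]
    push_cast
    linarith
  · simp only [translate]
    push_cast
    linarith
  · have := h.ray hx (ε := 1) (Or.inl rfl) (y := translate z (1 - ⌊z.1⌋)) (c := ⌊c⌋ - 2) ?_
    · simpa using this
    filter_upwards [hz] with n ⟨hn, j, hj⟩
    refine ⟨j - (1 - ⌊z.1⌋), ?_, ?_⟩
    · rw [hj] at hn
      simp only [translate] at hn
      have h3 : (⌊c⌋ - 2 - 1 : ℤ) < (j - (1 - ⌊z.1⌋) : ℤ) := by
        have := Int.floor_le c
        rify
        linarith
      linarith
    · rw [hj, translate_translate]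
      congr 1
      ring

/-! ### The retraction onto the skeleton -/

/-- The retraction onto the skeleton which contracts each ray to its starting point. -/
noncomputable def retract (x : Vertex) : Vertex :=
  if x.1 ≤ 0 then translate x (1 - ⌈x.1⌉) else if x.1 < 2 then x else translate x (1 - ⌊x.1⌋)

lemma retract_mem (x : Vertex) : retract x ∈ skeletonVertices := by
  have h1 := Int.le_ceil x.1
  have h2 := Int.ceil_lt_add_one x.1
  have h3 := Int.floor_le x.1
  have h4 := Int.lt_floor_add_one x.1
  unfold retract
  split_ifs <;> simp only [skeletonVertices, translate, Set.mem_ofPred_eq] <;> constructor <;>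
    push_cast <;> linarith

lemma retract_of_mem {x : Vertex} (hx : x ∈ skeletonVertices) : retract x = x := by
  rw [retract, if_neg (not_le.2 hx.1), if_pos hx.2]

lemma exists_retract_eq_translate (x : Vertex) : ∃ c : ℤ, retract x = translate x c := by
  unfold retract
  split_ifs
  · exact ⟨_, rfl⟩
  · exact ⟨0, (translate_zero x).symm⟩
  · exact ⟨_, rfl⟩

lemma retract_translate_neg {y : Vertex} (h0 : 0 < y.1) (h1 : y.1 ≤ 1) (n : ℕ) :
    retract (translate y (-(n : ℤ))) = y := by
  rcases Nat.eq_zero_or_pos n with rfl | hn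
  · simp only [Nat.cast_zero, neg_zero, translate_zero]
    exact retract_of_mem ⟨h0, by linarith⟩
  · have hn' : (1 : ℝ) ≤ n := by exact_mod_cast hn
    have hc : ⌈(translate y (-(n : ℤ))).1⌉ = 1 - n := by
      rw [Int.ceil_eq_iff]
      simp only [translate]
      push_cast
      constructor <;> linarith
    rw [retract, if_pos (by simp only [translate]; push_cast; linarith), hc, translate_translate]
    convert translate_zero y using 2
    ring

lemma retract_translate_pos {y : Vertex} (h0 : 1 ≤ y.1) (h1 : y.1 < 2) (n : ℕ) :
    retract (translate y (n : ℤ)) = y := by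
  rcases Nat.eq_zero_or_pos n with rfl | hn
  · simp only [Nat.cast_zero, translate_zero]
    exact retract_of_mem ⟨by linarith, h1⟩
  · have hn' : (1 : ℝ) ≤ n := by exact_mod_cast hn
    have hc : ⌊(translate y (n : ℤ)).1⌋ = 1 + n := by
      rw [Int.floor_eq_iff]
      simp only [translate]
      push_cast
      constructor <;> linarith
    rw [retract, if_neg (by simp only [translate]; push_cast; linarith),
      if_neg (by simp only [translate]; push_cast; linarith), hc, translate_translate]
    convert translate_zero y using 2
    ring

/-- Places each vertex on a ray that issues from its retraction and is collapsed to it as a whole,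
so that it can be joined to the skeleton without leaving that fibre. -/
lemma exists_translate_retract (x : Vertex) : ∃ (ε : ℤ) (n : ℕ), (ε = 1 ∨ ε = -1) ∧
    x = translate (retract x) (ε * n) ∧
      ∀ k : ℕ, retract (translate (retract x) (ε * k)) = retract x := by
  by_cases h0 : x.1 ≤ 0
  · have h1 := Int.le_ceil x.1
    have h2 := Int.ceil_lt_add_one x.1
    have e : retract x = translate x (1 - ⌈x.1⌉) := if_pos h0
    have h3 : ⌈x.1⌉ ≤ 0 := Int.ceil_le.2 (by simpa using h0)
    refine ⟨-1, (1 - ⌈x.1⌉).toNat, Or.inr rfl, ?_, fun k => ?_⟩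
    · rw [e, translate_translate, Int.toNat_of_nonneg (by omega)]
      conv_lhs => rw [← translate_zero x]
      congr 1
      ring
    · rw [neg_one_mul]
      refine retract_translate_neg ?_ ?_ k <;> rw [e] <;> simp only [translate] <;> push_cast <;>
        linarith
  by_cases h2 : x.1 < 2
  · have e : retract x = x := retract_of_mem ⟨not_le.1 h0, h2⟩
    rw [e]
    rcases le_or_gt x.1 1 with h1 | h1
    · refine ⟨-1, 0, Or.inr rfl, by simp [translate_zero], fun k => ?_⟩
      rw [neg_one_mul]
      exact retract_translate_neg (not_le.1 h0) h1 k
    · refine ⟨1, 0, Or.inl rfl, by simp [translate_zero], fun k => ?_⟩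
      rw [one_mul]
      exact retract_translate_pos h1.le h2 k
  · have h3 := Int.floor_le x.1
    have h4 := Int.lt_floor_add_one x.1
    have e : retract x = translate x (1 - ⌊x.1⌋) := by rw [retract, if_neg h0, if_neg h2]
    have h5 : 2 ≤ ⌊x.1⌋ := Int.le_floor.2 (by simpa using h2)
    refine ⟨1, (⌊x.1⌋ - 1).toNat, Or.inl rfl, ?_, fun k => ?_⟩
    · rw [e, translate_translate, Int.toNat_of_nonneg (by omega)]
      conv_lhs => rw [← translate_zero x]
      congr 1
      ring
    · rw [one_mul]
      refine retract_translate_pos ?_ ?_ k <;> rw [e] <;> simp only [translate] <;> push_cast <;>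
        linarith

/-- A vertex is connected to its retraction outside of `K`, unless `K` meets its ray. -/
lemma sameComp_retract {K : Set Vertex} {x : Vertex} (hx : retract x ∉ retract '' K) :
    SameComp schreier K x (retract x) := by
  obtain ⟨ε, n, hε, e, hr⟩ := exists_translate_retract x
  obtain ⟨g, hg, hgt⟩ := exists_genSet_act_eq_translate hε
  have hK : ∀ k : ℕ, translate (retract x) (ε * k) ∉ K := fun k hk => hx ⟨_, hk, hr k⟩
  have key : ∀ k : ℕ, SameComp schreier K (translate (retract x) (ε * k)) (retract x) := by
    intro k
    induction k with
    | zero =>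
      have := hK 0
      simp only [Nat.cast_zero, mul_zero, translate_zero] at this ⊢
      exact .refl this
    | succ k ih =>
      refine SameComp.trans (SameComp.symm ?_) ih
      refine .of_adj (hK k) (hK (k + 1)) ⟨fun h => ?_, g, hg, ?_⟩
      · have := translate_injective _ h
        rcases hε with rfl | rfl <;> push_cast at this <;> omega
      · rw [hgt, translate_translate]
        congr 1
        push_cast
        ring
  rw [e, hr]
  exact key n

lemma retract_translate_neg_one {x : Vertex} (hx : x.1 ≤ 1 ∨ 2 ≤ x.1) :
    retract (translate x (-1)) = retract x := by
  obtain hx | hx := hx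
  · rw [retract, if_pos (by simp only [translate]; push_cast; linarith), translate_translate]
    have e : ⌈(translate x (-1)).1⌉ = ⌈x.1⌉ - 1 := by
      simp only [translate]
      rw [Int.ceil_add_intCast]
      rfl
    rw [e]
    by_cases h : x.1 ≤ 0
    · rw [retract, if_pos h]
      congr 1
      ring
    · have e' : ⌈x.1⌉ = 1 := by
        rw [Int.ceil_eq_iff]
        push_cast
        constructor <;> linarith
      rw [retract, if_neg h, if_pos (by linarith), e']
      exact translate_zero x
  · have e : ⌊(translate x (-1)).1⌋ = ⌊x.1⌋ - 1 := by
      simp only [translate]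
      rw [Int.floor_add_intCast]
      rfl
    have t : (translate x (-1)).1 = x.1 - 1 := by
      simp only [translate]
      push_cast
      ring
    rw [retract, retract, if_neg (show ¬ (translate x (-1)).1 ≤ 0 by linarith),
      if_neg (show ¬ x.1 ≤ 0 by linarith), if_neg (show ¬ x.1 < 2 by linarith), e]
    split_ifs with h
    · have e' : ⌊x.1⌋ = 2 := by
        rw [Int.floor_eq_iff]
        push_cast
        constructor <;> linarith
      rw [e']
      norm_num
    · rw [translate_translate]
      congr 1
      ring

/-- Every edge is either collapsed by the retraction or lies in the skeleton, so the retraction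
carries walks to walks. -/
lemma retract_act_of_mem_genSet (x : Vertex) {g : FTilde} (hg : g ∈ genSet) :
    retract (act x g) = retract x ∨ x ∈ skeletonVertices ∧ act x g ∈ skeletonVertices := by
  have hA : ∀ x, retract (act x elA) = retract x ∨
      x ∈ skeletonVertices ∧ act x elA ∈ skeletonVertices := by
    intro x
    rw [act_elA]
    by_cases h : x.1 ≤ 1 ∨ 2 ≤ x.1
    · exact Or.inl (retract_translate_neg_one h)
    · push Not at h
      right
      simp only [skeletonVertices, translate, Set.mem_ofPred_eq]
      push_cast
      refine ⟨⟨?_, ?_⟩, ?_, ?_⟩ <;> linarith [h.1, h.2]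
  have hB : ∀ x, retract (act x elB) = retract x ∨
      x ∈ skeletonVertices ∧ act x elB ∈ skeletonVertices := by
    intro x
    have e : (act x elB).1 = toFun elB x.1 := rfl
    rw [toFun_elB] at e
    by_cases h0 : x.1 ≤ 0
    · rw [if_pos h0] at e
      left
      rw [Subtype.ext e]
    rw [if_neg h0] at e
    by_cases h2 : x.1 < 2
    · rw [if_pos h2.le] at e
      right
      simp only [skeletonVertices, Set.mem_ofPred_eq, e]
      refine ⟨⟨?_, ?_⟩, ?_, ?_⟩ <;> linarith
    · left
      have e' : act x elB = translate x (-1) := by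
        apply Subtype.ext
        rw [e, translate]
        push_cast
        -- At `x = 2` the branch `x / 2` agrees with `x - 1`.
        split_ifs <;> linarith
      rw [e']
      exact retract_translate_neg_one (Or.inr (not_lt.1 h2))
  have hinv : ∀ g, (∀ x, retract (act x g) = retract x ∨
      x ∈ skeletonVertices ∧ act x g ∈ skeletonVertices) →
      retract (act x g⁻¹) = retract x ∨ x ∈ skeletonVertices ∧ act x g⁻¹ ∈ skeletonVertices := by
    intro g h
    have h' := h (act x g⁻¹)
    rw [← act_mul, inv_mul_cancel, act_one] at h'
    exact h'.imp Eq.symm And.symm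
  rcases hg with rfl | rfl | rfl | rfl
  · exact hA x
  · exact hB x
  · exact hinv _ hA
  · exact hinv _ hB

/-! ### Ends of the skeleton inside the ends of the Schreier graph -/

/-- Skeleton vertices that are connected in the Schreier graph outside of `K` are also connected
in the skeleton. -/
lemma sameComp_skeleton {K : Finset Vertex} {x y : ↥skeletonVertices}
    (h : SameComp schreier (K : Set Vertex) x.1 y.1) :
    SameComp skeleton (skeletonPart K : Set ↥skeletonVertices) x y := by
  have hpart : ∀ z : ↥skeletonVertices,
      z ∉ (skeletonPart K : Set ↥skeletonVertices) ↔ z.1 ∉ (K : Set Vertex) := by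
    intro z
    simp [skeletonPart]
  -- The retraction of a walk avoiding `K` is followed edge by edge. It also avoids `K` once its
  -- start does: it is constant on collapsed edges, and on skeleton edges it agrees with the
  -- original walk.
  have key : ∀ (v w : ↥(K : Set Vertex)ᶜ) (_ : (schreier.induce (K : Set Vertex)ᶜ).Walk v w),
      retract v.1 ∉ (K : Set Vertex) →
      SameComp skeleton (skeletonPart K : Set ↥skeletonVertices)
        ⟨retract v.1, retract_mem _⟩ ⟨retract w.1, retract_mem _⟩ := by
    intro v w p
    induction p with
    | nil => exact fun hv => .refl ((hpart _).2 hv)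
    | @cons v u w hadj p ih =>
      intro hv
      have hadj' : schreier.Adj v.1 u.1 := hadj
      obtain ⟨hne, g, hg, hgu⟩ := hadj'
      have hr := retract_act_of_mem_genSet v.1 hg
      rw [hgu] at hr
      obtain hr | ⟨hv', hu'⟩ := hr
      · have := ih (by rwa [hr])
        convert this using 2
        exact hr.symm
      · have hu : retract u.1 ∉ (K : Set Vertex) := by
          rw [retract_of_mem hu']
          exact u.2
        refine SameComp.trans (.of_adj ((hpart _).2 hv) ((hpart _).2 hu) ?_) (ih hu)
        change schreier.Adj (retract v.1) (retract u.1)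
        rw [retract_of_mem hv', retract_of_mem hu']
        exact ⟨hne, g, hg, hgu⟩
  obtain ⟨C, ⟨hx, hxC⟩, ⟨hy, hyC⟩⟩ := h
  obtain ⟨p⟩ := SimpleGraph.ConnectedComponent.exact (hxC.trans hyC.symm)
  have := key _ _ p (by rw [retract_of_mem x.2]; exact hx)
  convert this using 1
  · exact Subtype.ext (retract_of_mem x.2).symm
  · exact Subtype.ext (retract_of_mem y.2).symm

lemma sameComp_of_skeleton {K : Finset Vertex} {x y : ↥skeletonVertices}
    (h : SameComp skeleton (skeletonPart K : Set ↥skeletonVertices) x y) :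
    SameComp schreier (K : Set Vertex) x.1 y.1 := by
  have hpart : ∀ z : ↥skeletonVertices,
      z ∉ (skeletonPart K : Set ↥skeletonVertices) → z.1 ∉ (K : Set Vertex) := by
    intro z
    simp [skeletonPart]
  let f : skeleton.ComponentCompl (skeletonPart K : Set ↥skeletonVertices) →
      schreier.ComponentCompl (K : Set Vertex) :=
    SimpleGraph.ComponentCompl.lift (fun _ hv => schreier.componentComplMk (hpart _ hv))
      fun _ _ hv hw hadj => schreier.componentComplMk_eq_of_adj (hpart _ hv) (hpart _ hw) hadj
  obtain ⟨C, ⟨hx, hxC⟩, ⟨hy, hyC⟩⟩ := h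
  exact ⟨f C, ⟨hpart _ hx, by rw [← hxC]; rfl⟩, ⟨hpart _ hy, by rw [← hyC]; rfl⟩⟩

/-- The ends all of whose neighbourhoods meet the skeleton. -/
def endsNearSkeleton : Set Ends :=
  {ω | ∀ K : Finset Vertex, ∃ y ∈ skeletonVertices, y ∈ (ω.comp K).supp}

/-- By `sameComp_skeleton`, all skeleton vertices in the component chosen by `ω` lie in one
component of the skeleton without `K`. These components are compatible and form the required end of
the skeleton. -/
lemma endsNearSkeleton_subset : endsNearSkeleton ⊆ endsSkeleton := by
  classical
  intro ω hω
  choose y hy hyω using hω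
  let s : Finset Vertex → ↥skeletonVertices := fun K => ⟨y K, hy K⟩
  let e : Finset ↥skeletonVertices → Finset Vertex := fun L => L.image Subtype.val
  -- Lets the representatives, indexed by finite sets of vertices, also serve for finite subsets of
  -- the skeleton.
  have he : ∀ L, skeletonPart (e L) = L := by
    intro L
    ext z
    simp [skeletonPart, e]
  have hsame : ∀ {K L : Finset Vertex}, K ⊆ L →
      SameComp skeleton (skeletonPart K : Set ↥skeletonVertices) (s K) (s L) := fun h =>
    sameComp_skeleton (.of_mem (hyω _) (ω.supp_mono h (hyω _)))
  have hs : ∀ L : Finset ↥skeletonVertices, s (e L) ∉ (L : Set ↥skeletonVertices) := by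
    intro L
    have := (hsame (Finset.Subset.refl (e L)))
    rw [he] at this
    obtain ⟨C, ⟨h, -⟩, -⟩ := this
    exact h
  refine ⟨fun L => skeleton.componentComplMk (hs L.unop), ?_, fun K z hz => ?_⟩
  · intro L M f
    have hML : M.unop ⊆ L.unop := CategoryTheory.le_of_op_hom f
    have h := hsame (Finset.image_subset_image (f := Subtype.val) hML)
    rw [he] at h
    exact (h.componentComplMk_eq (hs _) (Set.notMem_subset (by exact_mod_cast hML) (hs L.unop))).symm
  · have hsub : e (skeletonPart K) ⊆ K := by
      intro v hv
      obtain ⟨w, hw, rfl⟩ := Finset.mem_image.1 hv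
      simpa [skeletonPart] using hw
    have h1 := hsame hsub
    rw [he] at h1
    have h2 : SameComp skeleton (skeletonPart K : Set ↥skeletonVertices)
        (s (e (skeletonPart K))) z := .of_mem ⟨hs _, rfl⟩ hz
    exact (sameComp_of_skeleton (h1.symm.trans h2)).mem_supp (hyω K)

/-- Once the retraction of `x n` has left the finite set `retract '' K`, the ray through `x n`
avoids `K` and joins it to the skeleton. -/
lemma mem_endsNearSkeleton {x : ℕ → Vertex} {ω : Ends} (h : ConvergesToEnd x ω)
    (hx : Tendsto (fun n => retract (x n)) atTop cofinite) : ω ∈ endsNearSkeleton := by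
  intro K
  have hfin : (retract '' (K : Set Vertex)).Finite := K.finite_toSet.image _
  obtain ⟨n, hn, hn'⟩ := ((h K).and (hx.eventually hfin.compl_mem_cofinite)).exists
  exact ⟨retract (x n), retract_mem _, (sameComp_retract hn').mem_supp hn⟩

/-! ## Random walks -/

variable {μ : PMF FTilde}

lemma ae_mem_support (μ : PMF FTilde) : ∀ᵐ h ∂μ.toMeasure, h ∈ μ.support := by
  rw [ae_iff, ← Set.compl_ofPred, Set.ofPred_mem_eq]
  exact (μ.toMeasure_apply_eq_zero_iff (MeasurableSet.of_discrete)).2 disjoint_compl_right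

lemma integrable_of_finite_support (hfin : μ.support.Finite) (f : FTilde → ℝ) :
    Integrable f μ.toMeasure := by
  obtain ⟨C, hC⟩ := (hfin.image fun h => ‖f h‖).bddAbove
  refine Integrable.of_bound (measurable_of_countable f).aestronglyMeasurable C ?_
  filter_upwards [ae_mem_support μ] with h hh
  exact hC ⟨h, hh, rfl⟩

lemma integral_eq_sum_support (hfin : μ.support.Finite) (f : FTilde → ℝ) :
    ∫ h, f h ∂μ.toMeasure = ∑ h ∈ hfin.toFinset, (μ h).toReal * f h := by
  rw [PMF.integral_eq_tsum μ f (integrable_of_finite_support hfin f)]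
  refine tsum_eq_sum fun h hh => ?_
  have : μ h = 0 := by simpa using hh
  simp [this]

lemma isStepWeight (hfin : μ.support.Finite) (hgen : Subsemigroup.closure μ.support = ⊤) :
    IsStepWeight hfin.toFinset fun h => (μ h).toReal where
  pos h hh := ENNReal.toReal_pos (by simpa using hh) (μ.apply_ne_top h)
  sum_eq_one := by
    have := integral_eq_sum_support hfin fun _ => 1
    simpa using this.symm
  closure_eq_top := by simpa using hgen

lemma barycentre_imageMeasure (hfin : μ.support.Finite) (χ : FTilde →* Multiplicative ℤ) :
    barycentre (imageMeasure χ μ) =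
      ∑ h ∈ hfin.toFinset, (μ h).toReal * ((χ h).toAdd : ℝ) := by
  have hm : Measurable fun g : FTilde => (χ g).toAdd := measurable_of_countable _
  have hm' : Measurable fun k : ℤ => (k : ℝ) := measurable_of_countable _
  have e : (imageMeasure χ μ).toMeasure = μ.toMeasure.map fun g => (χ g).toAdd :=
    (PMF.toMeasure_map _ _ hm).symm
  have hint : Integrable (fun k : ℤ => (k : ℝ)) (imageMeasure χ μ).toMeasure := by
    rw [e, integrable_map_measure hm'.aestronglyMeasurable hm.aemeasurable]
    exact integrable_of_finite_support hfin _
  have h := PMF.integral_eq_tsum (imageMeasure χ μ) (fun k : ℤ => (k : ℝ)) hint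
  rw [e, integral_map hm.aemeasurable hm'.aestronglyMeasurable,
    integral_eq_sum_support hfin fun g => ((χ g).toAdd : ℝ)] at h
  exact h.symm

/-- The law of the increments of the random walk. -/
noncomputable def stepMeasure (μ : PMF FTilde) : Measure (ℕ → FTilde) :=
  Measure.infinitePi fun _ : ℕ => μ.toMeasure

instance (μ : PMF FTilde) : IsProbabilityMeasure (stepMeasure μ) :=
  inferInstanceAs (IsProbabilityMeasure (Measure.infinitePi fun _ : ℕ => μ.toMeasure))

lemma map_eval_stepMeasure (μ : PMF FTilde) (n : ℕ) :
    (stepMeasure μ).map (fun h => h n) = μ.toMeasure := Measure.infinitePi_map_eval _ n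

lemma iIndepFun_stepMeasure (μ : PMF FTilde) {β : Type*} [MeasurableSpace β] (f : FTilde → β) :
    iIndepFun (fun (n : ℕ) (h : ℕ → FTilde) => f (h n)) (stepMeasure μ) :=
  iIndepFun_infinitePi (X := fun _ : ℕ => f) fun _ => measurable_from_top

lemma ae_forall_mem_support (μ : PMF FTilde) :
    ∀ᵐ h ∂stepMeasure μ, ∀ n, h n ∈ μ.support := by
  refine ae_all_iff.2 fun n => ?_
  have := ae_mem_support μ
  rw [← map_eval_stepMeasure μ n] at this
  exact ae_of_ae_map (measurable_pi_apply n).aemeasurable this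

/-! ### Walks on the integers with nonnegative drift -/

/-- Second Borel–Cantelli lemma for independent events of equal positive probability. -/
lemma ae_frequently_ne_zero {f : FTilde → ℤ} (hf : ∃ h ∈ μ.support, f h ≠ 0) :
    ∀ᵐ h ∂stepMeasure μ, ∃ᶠ n in atTop, f (h n) ≠ 0 := by
  have hms : ∀ n : ℕ, MeasurableSet {h : ℕ → FTilde | f (h n) ≠ 0} := fun n =>
    measurable_pi_apply (X := fun _ : ℕ => FTilde) n
      (MeasurableSet.of_discrete (s := {g : FTilde | f g ≠ 0}))
  have hindep : iIndepSet (fun n : ℕ => {h : ℕ → FTilde | f (h n) ≠ 0}) (stepMeasure μ) := by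
    rw [iIndepSet_iff_meas_biInter hms]
    intro s
    exact (iIndepFun_stepMeasure μ f).meas_biInter fun n _ =>
      ⟨{0}ᶜ, MeasurableSet.of_discrete, rfl⟩
  have hone := measure_limsup_eq_one hms hindep ?_
  · have : ∀ᵐ h ∂stepMeasure μ, h ∈ limsup (fun n : ℕ => {h : ℕ → FTilde | f (h n) ≠ 0}) atTop :=
      (prob_compl_eq_zero_iff (MeasurableSet.measurableSet_limsup hms)).2 hone
    filter_upwards [this] with h hh
    rwa [mem_limsup_iff_frequently_mem] at hh
  · have : ∀ n : ℕ, stepMeasure μ {h : ℕ → FTilde | f (h n) ≠ 0} =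
        μ.toMeasure {g | f g ≠ 0} := by
      intro n
      rw [← map_eval_stepMeasure μ n, Measure.map_apply (measurable_pi_apply n)
        MeasurableSet.of_discrete]
      rfl
    simp_rw [this]
    refine ENNReal.tsum_const_eq_top_of_ne_zero fun h0 => ?_
    rw [PMF.toMeasure_apply_eq_zero_iff _ MeasurableSet.of_discrete] at h0
    obtain ⟨g, hg, hne⟩ := hf
    exact Set.disjoint_left.1 h0 hg hne

lemma eventually_eq_of_tendsto_intCast {s : ℕ → ℤ} {c : ℝ}
    (h : Tendsto (fun n => (s n : ℝ)) atTop (𝓝 c)) : ∀ᶠ n in atTop, s (n + 1) = s n := by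
  have h1 := (h.comp (tendsto_add_atTop_nat 1)).sub h
  rw [sub_self] at h1
  filter_upwards [h1.eventually (Metric.ball_mem_nhds 0 one_pos)] with n hn
  simp only [Function.comp_apply, dist_zero_right, Real.norm_eq_abs] at hn
  have h2 : |s (n + 1) - s n| < 1 := by exact_mod_cast hn
  have := Int.abs_lt_one_iff.1 h2
  omega

/-- A nondegenerate walk on the integers with finitely supported steps and nonnegative drift is
almost surely unbounded above. -/
theorem ae_not_bddAbove_sum (hfin : μ.support.Finite) {f : FTilde → ℤ}
    (hf : ∃ h ∈ μ.support, f h ≠ 0)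
    (hmean : 0 ≤ ∑ h ∈ hfin.toFinset, (μ h).toReal * (f h : ℝ)) :
    ∀ᵐ h ∂stepMeasure μ,
      ¬ BddAbove (Set.range fun n => ((∑ i ∈ Finset.range n, f (h i) : ℤ) : ℝ)) := by
  set X : ℕ → (ℕ → FTilde) → ℝ := fun n h => (f (h n) : ℝ)
  have hXm : ∀ n, StronglyMeasurable (X n) := fun n =>
    ((measurable_of_countable fun g : FTilde => (f g : ℝ)).comp
      (measurable_pi_apply n)).stronglyMeasurable
  have hXint : ∀ n, Integrable (X n) (stepMeasure μ) := by
    intro n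
    have := integrable_of_finite_support hfin fun g => (f g : ℝ)
    rw [← map_eval_stepMeasure μ n] at this
    exact this.comp_measurable (measurable_pi_apply n)
  have hXmean : ∀ n, 0 ≤ ∫ h, X n h ∂stepMeasure μ := by
    intro n
    have h1 : ∫ h, X n h ∂stepMeasure μ = ∫ g, (f g : ℝ) ∂((stepMeasure μ).map fun h => h n) :=
      (integral_map (φ := fun h : ℕ → FTilde => h n) (f := fun g : FTilde => (f g : ℝ))
        (measurable_pi_apply n).aemeasurable
        (measurable_of_countable _).aestronglyMeasurable).symm
    rwa [h1, map_eval_stepMeasure, integral_eq_sum_support hfin]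
  let ℱ := Filtration.natural X hXm
  -- The range `n + 1` makes `W n` adapted to the natural filtration of the increments, whose time
  -- `n` already knows `X n`.
  let W : ℕ → (ℕ → FTilde) → ℝ := fun n => ∑ i ∈ Finset.range (n + 1), X i
  have hsub : Submartingale W ℱ (stepMeasure μ) := by
    refine submartingale_of_condExp_sub_nonneg_nat (fun n => ?_) (fun n => ?_) fun n => ?_
    · refine Finset.stronglyMeasurable_sum _ fun i hi => ?_
      exact (Filtration.stronglyAdapted_natural hXm i).mono
        (ℱ.mono (Nat.lt_succ_iff.1 (Finset.mem_range.1 hi)))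
    · exact integrable_finsetSum' _ fun i _ => hXint i
    · have e : W (n + 1) - W n = X (n + 1) := by
        simp only [W]
        rw [Finset.sum_range_succ _ (n + 1), add_sub_cancel_left]
      rw [e]
      have hind : iIndepFun X (stepMeasure μ) := iIndepFun_stepMeasure μ fun g => (f g : ℝ)
      have := hind.condExp_natural_ae_eq_of_lt hXm (Nat.lt_succ_self n)
      filter_upwards [this] with h hh
      rw [hh]
      exact hXmean (n + 1)
  obtain ⟨R, hR⟩ := (hfin.image fun h => |(f h : ℝ)|).bddAbove
  have hbdd : ∀ᵐ h ∂stepMeasure μ, ∀ i, |W (i + 1) h - W i h| ≤ (R.toNNReal : ℝ) := by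
    filter_upwards [ae_forall_mem_support μ] with h hh i
    have e : W (i + 1) h - W i h = (f (h (i + 1)) : ℝ) := by
      simp only [W, Finset.sum_apply]
      rw [Finset.sum_range_succ _ (i + 1), add_sub_cancel_left]
    rw [e]
    exact (hR ⟨_, hh _, rfl⟩).trans (Real.le_coe_toNNReal R)
  filter_upwards [hsub.bddAbove_iff_exists_tendsto hbdd, ae_frequently_ne_zero hf]
    with h h1 h2 hbd
  have hW : ∀ n, W n h = ((∑ i ∈ Finset.range (n + 1), f (h i) : ℤ) : ℝ) := by
    intro n
    simp [W, X]
  have h3 : BddAbove (Set.range fun n => W n h) := by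
    refine hbd.mono ?_
    rintro _ ⟨n, rfl⟩
    exact ⟨n + 1, (hW n).symm⟩
  -- A submartingale with bounded increments converges almost surely where it is bounded above.
  -- Being integer valued it would then be eventually constant, against infinitely many nonzero
  -- steps.
  obtain ⟨c, hc⟩ := h1.1 h3
  simp only [hW] at hc
  have h4 := eventually_eq_of_tendsto_intCast hc
  obtain ⟨N, hN⟩ := eventually_atTop.1 h4
  obtain ⟨n, hn, hne⟩ := frequently_atTop.1 h2 (N + 1)
  obtain ⟨k, rfl⟩ : ∃ k, n = k + 1 := ⟨n - 1, by omega⟩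
  have := hN k (by omega)
  rw [Finset.sum_range_succ _ (k + 1)] at this
  exact hne (by linarith)

/-! ### The induced Markov chain -/

lemma positions_congr {h h' : ℕ → FTilde} (n : ℕ) (e : ∀ i < n, h i = h' i) :
    positions h n = positions h' n := by
  induction n with
  | zero => rfl
  | succ n ih =>
    rw [positions, positions, ih fun i hi => e i (by omega), e n (by omega)]

lemma measurable_positions_apply (n : ℕ) : Measurable fun h : ℕ → FTilde => positions h n :=
  (measurable_pi_apply n).comp measurable_positions

lemma indepFun_positions (μ : PMF FTilde) (n : ℕ) :
    IndepFun (fun h => positions h n) (fun h => h n) (stepMeasure μ) := by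
  have h := (iIndepFun_stepMeasure μ id).indepFun_finset (Finset.range n) {n} (by simp)
    fun i => measurable_pi_apply i
  -- Padding by `1` exhibits the position at time `n` as a function of the first `n` increments
  -- alone.
  let ext : ((Finset.range n) → FTilde) → ℕ → FTilde := fun t i =>
    if hi : i ∈ Finset.range n then t ⟨i, hi⟩ else 1
  have h2 := h.comp (φ := fun t => positions (ext t) n) (ψ := fun t => t ⟨n, by simp⟩)
    (measurable_of_countable _) (measurable_of_countable _)
  convert h2 using 1
  · ext1 k
    refine positions_congr n fun i hi => ?_
    simp [ext, hi]
  · rfl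

/-- The Markov property: the last increment is independent of the position before it, so Fubini
integrates it first. -/
lemma integral_positions_succ (hfin : μ.support.Finite) {φ : Vertex → ℝ} {C : ℝ}
    (hφ : ∀ z, |φ z| ≤ C) (x : Vertex) (n : ℕ) :
    ∫ h, φ (act x (positions h (n + 1))) ∂stepMeasure μ =
      ∫ h, stepOp hfin.toFinset (fun g => (μ g).toReal) φ (act x (positions h n))
        ∂stepMeasure μ := by
  have hp := measurable_positions_apply n
  have hind := (indepFun_iff_map_prod_eq_prod_map_map hp.aemeasurable
    (measurable_pi_apply (X := fun _ : ℕ => FTilde) n).aemeasurable).1 (indepFun_positions μ n)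
  rw [map_eval_stepMeasure] at hind
  have hF : Measurable fun p : FTilde × FTilde => φ (act x (p.1 * p.2)) :=
    measurable_of_countable _
  have : IsProbabilityMeasure ((stepMeasure μ).map fun h => positions h n) :=
    Measure.isProbabilityMeasure_map hp.aemeasurable
  have h1 : ∫ h, φ (act x (positions h (n + 1))) ∂stepMeasure μ =
      ∫ p : FTilde × FTilde, φ (act x (p.1 * p.2))
        ∂((stepMeasure μ).map fun h => (positions h n, h n)) :=
    (integral_map (hp.prodMk (measurable_pi_apply n)).aemeasurable hF.aestronglyMeasurable).symm
  rw [h1, hind, integral_prod, integral_map hp.aemeasurable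
    (measurable_of_countable _).aestronglyMeasurable]
  · refine integral_congr_ae (Eventually.of_forall fun h => ?_)
    exact integral_eq_sum_support hfin fun g => φ (act x (positions h n * g))
  · exact Integrable.of_bound hF.aestronglyMeasurable C (Eventually.of_forall fun p => hφ _)

lemma integral_positions (hfin : μ.support.Finite) (hgen : Subsemigroup.closure μ.support = ⊤)
    {φ : Vertex → ℝ} (h0 : 0 ≤ φ) (h1 : φ ≤ 1) (x : Vertex) (n : ℕ) :
    ∫ h, φ (act x (positions h n)) ∂stepMeasure μ =
      (stepOp hfin.toFinset (fun g => (μ g).toReal) ^ n) φ x := by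
  have hS := isStepWeight hfin hgen
  induction n generalizing φ with
  | zero => simp [positions, act_one]
  | succ n ih =>
    rw [integral_positions_succ hfin (C := 1) (fun z => by
        rw [abs_of_nonneg (h0 z)]
        exact h1 z), ih, pow_succ, Module.End.mul_apply]
    · simpa using hS.stepOp_mono h0
    · have := hS.stepOp_mono h1
      have e := hS.stepOp_pow_one 1
      rw [pow_one] at e
      rwa [e] at this

/-- A set of vertices with bounded expected number of visits is almost surely visited finitely
often. -/
lemma ae_eventually_act_notMem (hfin : μ.support.Finite)
    (hgen : Subsemigroup.closure μ.support = ⊤) (T : Set Vertex) (x : Vertex) {C : ℝ}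
    (hC : ∀ N, ∑ n ∈ Finset.range N,
      (stepOp hfin.toFinset (fun g => (μ g).toReal) ^ n) (T.indicator 1) x ≤ C) :
    ∀ᵐ h ∂stepMeasure μ, ∀ᶠ n in atTop, act x (positions h n) ∉ T := by
  have hms : ∀ n, MeasurableSet {h : ℕ → FTilde | act x (positions h n) ∈ T} := fun n =>
    measurable_positions_apply n (MeasurableSet.of_discrete (s := {g : FTilde | act x g ∈ T}))
  have hreal : ∀ n, (stepMeasure μ).real {h | act x (positions h n) ∈ T} =
      (stepOp hfin.toFinset (fun g => (μ g).toReal) ^ n) (T.indicator 1) x := by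
    intro n
    rw [← integral_positions hfin hgen (φ := T.indicator 1)
      (Set.indicator_nonneg fun _ _ => zero_le_one)
      (Set.indicator_le_self' fun _ _ => zero_le_one), ← integral_indicator_one (hms n)]
    rfl
  have hsum : Summable fun n => (stepMeasure μ).real {h | act x (positions h n) ∈ T} :=
    summable_of_sum_range_le (fun n => measureReal_nonneg) fun N => by
      simpa only [hreal] using hC N
  -- First Borel–Cantelli lemma: the expected number of visits is the sum of these probabilities.
  refine MeasureTheory.ae_eventually_notMem (μ := stepMeasure μ)
    (s := fun n => {h | act x (positions h n) ∈ T}) ?_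
  have e : ∀ n, stepMeasure μ {h | act x (positions h n) ∈ T} =
      ENNReal.ofReal ((stepMeasure μ).real {h | act x (positions h n) ∈ T}) := fun n =>
    (ofReal_measureReal).symm
  simp_rw [e]
  rw [← ENNReal.ofReal_tsum_of_nonneg (fun n => measureReal_nonneg) hsum]
  exact ENNReal.ofReal_ne_top

lemma countable_vertex : Countable Vertex := by
  have : {x : ℝ | IsDyadic x} ⊆ Set.range fun p : ℤ × ℕ => (p.1 : ℝ) / 2 ^ p.2 := by
    rintro _ ⟨k, n, rfl⟩
    exact ⟨(k, n), rfl⟩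
  exact ((Set.countable_range _).mono this).to_subtype

instance : Countable Vertex := countable_vertex

/-- The induced Markov chain on the vertices is transient. -/
theorem ae_tendsto_cofinite (hfin : μ.support.Finite)
    (hgen : Subsemigroup.closure μ.support = ⊤) :
    ∀ᵐ h ∂stepMeasure μ, ∀ x, Tendsto (fun n => act x (positions h n)) atTop cofinite := by
  refine ae_all_iff.2 fun x => ?_
  have h1 : ∀ᵐ h ∂stepMeasure μ, ∀ y : Vertex, ∀ᶠ n in atTop,
      act x (positions h n) ∉ ({y} : Set Vertex) := by
    refine ae_all_iff.2 fun y => ?_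
    obtain ⟨C, hC⟩ := (isStepWeight hfin hgen).sum_stepOp_pow_singleton_le x y
    exact ae_eventually_act_notMem hfin hgen {y} x hC
  filter_upwards [h1] with h hh
  exact le_cofinite_iff_eventually_ne.2 fun y => eventually_map.2 (hh y)

/-! ## Visits to bounded sets -/

/-- Bounded displacement holds for the generators and passes to products and inverses. It is what
prevents a step from jumping across the strip. -/
lemma exists_abs_toFun_sub_le (g : FTilde) : ∃ d : ℝ, ∀ x, |toFun g x - x| ≤ d := by
  induction g using FTilde.induction with
  | hA => exact ⟨1, fun x => by rw [toFun_elA]; simp⟩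
  | hB =>
    refine ⟨1, fun x => abs_le.2 ?_⟩
    rw [toFun_elB]
    split_ifs <;> constructor <;> linarith
  | one => exact ⟨0, fun x => by simp [toFun_one]⟩
  | mul f g hf hg =>
    obtain ⟨c, hc⟩ := hf
    obtain ⟨d, hd⟩ := hg
    refine ⟨d + c, fun x => ?_⟩
    rw [toFun_mul]
    exact (abs_sub_le _ (toFun f x) _).trans (add_le_add (hd _) (hc x))
  | inv g hg =>
    obtain ⟨c, hc⟩ := hg
    refine ⟨c, fun x => ?_⟩
    have := hc (toFun g⁻¹ x)
    rwa [← toFun_mul, inv_mul_cancel, toFun_one, abs_sub_comm] at this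

/-- All elements of `S` are translations on both sides of `[-M, M]` and move no point by more
than `M`. -/
structure IsStepBound (S : Finset FTilde) (M : ℝ) : Prop where
  pos : 0 < M
  bot : ∀ h ∈ S, ∀ x ≤ -M, toFun h x = x + shiftBot h
  top : ∀ h ∈ S, ∀ x, M ≤ x → toFun h x = x + shiftTop h
  displacement_le : ∀ h ∈ S, ∀ x, |toFun h x - x| ≤ M

lemma exists_isStepBound (S : Finset FTilde) : ∃ M, IsStepBound S M := by
  have h1 : ∀ g : FTilde, ∃ M : ℝ, (∀ x ≤ -M, toFun g x = x + shiftBot g) ∧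
      (∀ x, M ≤ x → toFun g x = x + shiftTop g) ∧ ∀ x, |toFun g x - x| ≤ M := by
    intro g
    obtain ⟨a, ha⟩ := eventually_atBot.1 (shiftBot_spec g)
    obtain ⟨b, hb⟩ := eventually_atTop.1 (shiftTop_spec g)
    obtain ⟨d, hd⟩ := exists_abs_toFun_sub_le g
    refine ⟨max (max (-a) b) d, fun x hx => ha x ?_, fun x hx => hb x ?_, fun x =>
      (hd x).trans (le_max_right _ _)⟩
    · have := (le_max_left (-a) b).trans (le_max_left _ d)
      linarith
    · exact ((le_max_right (-a) b).trans (le_max_left _ d)).trans hx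
  choose f hbot htop habs using h1
  obtain ⟨M, hM⟩ := (S.image f).exists_le
  have hM' : ∀ h ∈ S, f h ≤ max M 1 := fun h hh =>
    (hM _ (Finset.mem_image_of_mem f hh)).trans (le_max_left _ _)
  exact ⟨max M 1, lt_of_lt_of_le one_pos (le_max_right _ _),
    fun h hh x hx => hbot h x (by linarith [hM' h hh]),
    fun h hh x hx => htop h x ((hM' h hh).trans hx), fun h hh x => (habs h x).trans (hM' h hh)⟩

variable {M : ℝ}

lemma IsStepBound.act_bot (hM : IsStepBound S M) {h : FTilde} (hh : h ∈ S) {z : Vertex}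
    (hz : z.1 ≤ -M) : act z h = translate z (shiftBot h) := Subtype.ext (hM.bot h hh _ hz)

lemma IsStepBound.act_top (hM : IsStepBound S M) {h : FTilde} (hh : h ∈ S) {z : Vertex}
    (hz : M ≤ z.1) : act z h = translate z (shiftTop h) := Subtype.ext (hM.top h hh _ hz)

lemma IsStepBound.abs_act_sub_le (hM : IsStepBound S M) {h : FTilde} (hh : h ∈ S) (z : Vertex) :
    |(act z h).1 - z.1| ≤ M := hM.displacement_le h hh _

/-- The exponential moment has value `1` and negative derivative at `θ = 0`. An explicit `θ` comes
from `exp t ≤ 1 + t + t²` for `|t| ≤ 1`. -/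
lemma IsStepWeight.exists_sum_exp_le_one (hS : IsStepWeight S m) {f : FTilde → ℝ}
    (hf : ∑ h ∈ S, m h * f h < 0) : ∃ θ : ℝ, 0 < θ ∧ ∑ h ∈ S, m h * Real.exp (θ * f h) ≤ 1 := by
  obtain ⟨R₀, hR₀⟩ := (S.image fun h => |f h|).exists_le
  set R := max R₀ 1
  have hR1 : 1 ≤ R := le_max_right _ _
  have hR : ∀ h ∈ S, |f h| ≤ R := fun h hh =>
    (hR₀ _ (Finset.mem_image_of_mem (fun h => |f h|) hh)).trans (le_max_left _ _)
  set E := -∑ h ∈ S, m h * f h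
  have hE : 0 < E := neg_pos.2 hf
  -- The first bound gives `|θ * f h| ≤ 1`, the second makes the quadratic error `(θ * R) ^ 2` at
  -- most the gain `θ * E`.
  set θ := min (1 / R) (E / R ^ 2)
  have hθ : 0 < θ := lt_min (by positivity) (by positivity)
  have hθ1 : θ * R ≤ 1 := (le_div_iff₀ (by positivity)).1 (min_le_left _ _)
  have hθ2 : θ * R ^ 2 ≤ E := (le_div_iff₀ (by positivity)).1 (min_le_right _ _)
  refine ⟨θ, hθ, ?_⟩
  have hterm : ∀ h ∈ S, m h * Real.exp (θ * f h) ≤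
      m h * (1 + (θ * R) ^ 2) + θ * (m h * f h) := by
    intro h hh
    have h1 : |θ * f h| ≤ θ * R := by
      rw [abs_mul, abs_of_pos hθ]
      exact mul_le_mul_of_nonneg_left (hR h hh) hθ.le
    have h2 := (abs_le.1 (Real.abs_exp_sub_one_sub_id_le (h1.trans hθ1))).2
    have h3 : (θ * f h) ^ 2 ≤ (θ * R) ^ 2 := sq_le_sq.2 (h1.trans (le_abs_self _))
    have h4 := mul_le_mul_of_nonneg_left
      (show Real.exp (θ * f h) ≤ 1 + (θ * R) ^ 2 + θ * f h by linarith) (hS.pos h hh).le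
    linarith
  refine (Finset.sum_le_sum hterm).trans ?_
  rw [Finset.sum_add_distrib, ← Finset.sum_mul, ← Finset.mul_sum, hS.sum_eq_one]
  have h5 : ∑ h ∈ S, m h * f h = -E := (neg_neg _).symm
  rw [h5]
  nlinarith [mul_le_mul_of_nonneg_left hθ2 hθ.le]

/-- If a position function changes by increments with negative drift as long as it is negative,
then the sets on which it is nonnegative and from which it can be made negative by a fixed group
element are visited only finitely often in mean. -/
lemma IsStepWeight.sum_stepOp_pow_indicator_le_of_drift (hS : IsStepWeight S m) {p : Vertex → ℝ}
    {f : FTilde → ℝ} (hf : ∑ h ∈ S, m h * f h < 0)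
    (hp : ∀ h ∈ S, ∀ z, p z ≤ 0 → p (act z h) = p z + f h) {T : Set Vertex}
    (hT : ∀ z ∈ T, 0 ≤ p z) {g : FTilde} (hg : ∀ z ∈ T, p (act z g) ≤ -1) :
    ∃ C : ℝ, ∀ x N, ∑ n ∈ Finset.range N, (stepOp S m ^ n) (T.indicator 1) x ≤ C := by
  obtain ⟨θ, hθ, hsum⟩ := hS.exists_sum_exp_le_one hf
  -- The exponential is superharmonic where `p ≤ 0`, and truncation at `1` makes the inequality
  -- trivial where `p ≥ 0`. It equals `1` on `T`, and the move by `g` brings it down to at most `exp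
  -- (-θ)`.
  set φ : Vertex → ℝ := fun z => min 1 (Real.exp (θ * p z))
  have h1 : φ ≤ 1 := fun z => min_le_left _ _
  refine hS.sum_stepOp_pow_indicator_le (φ := φ) (fun z => le_min zero_le_one (Real.exp_pos _).le)
    h1 (fun z => le_min ?_ ?_) (fun z hz => ?_) (g := g) (δ := 1 - Real.exp (-θ)) ?_ fun z hz => ?_
  · have := hS.stepOp_mono h1 z
    have e := congrFun (hS.stepOp_pow_one 1) z
    rw [pow_one] at e
    rwa [e] at this
  · rcases le_total (p z) 0 with hz | hz
    · rw [stepOp_apply]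
      calc ∑ h ∈ S, m h * φ (act z h)
          ≤ ∑ h ∈ S, Real.exp (θ * p z) * (m h * Real.exp (θ * f h)) := by
            refine Finset.sum_le_sum fun h hh => ?_
            have h2 : φ (act z h) ≤ Real.exp (θ * p z) * Real.exp (θ * f h) := by
              rw [← Real.exp_add, ← mul_add, ← hp h hh z hz]
              exact min_le_right _ _
            have := mul_le_mul_of_nonneg_left h2 (hS.pos h hh).le
            linarith
        _ ≤ Real.exp (θ * p z) := by
            rw [← Finset.mul_sum]
            exact mul_le_of_le_one_right (Real.exp_pos _).le hsum
    · have := hS.stepOp_mono h1 z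
      have e := congrFun (hS.stepOp_pow_one 1) z
      rw [pow_one] at e
      rw [e] at this
      exact this.trans (Real.one_le_exp (mul_nonneg hθ.le hz))
  · exact min_eq_left (Real.one_le_exp (mul_nonneg hθ.le (hT z hz)))
  · have := Real.exp_lt_exp.2 (neg_lt_zero.2 hθ)
    rw [Real.exp_zero] at this
    linarith
  · refine (min_le_right _ _).trans ?_
    rw [sub_sub_cancel]
    exact Real.exp_le_exp.2 (by nlinarith [hg z hz])

/-- The strip holds infinitely many vertices, so transience alone does not suffice. The function `z
+ M` has the required drift below `-M`, and translation by `-(⌈2M⌉ + 1)` moves the strip to where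
this function is at most `-1`. -/
lemma IsStepWeight.sum_stepOp_pow_indicator_abs_le_of_bot (hS : IsStepWeight S m)
    (hM : IsStepBound S M) (hf : ∑ h ∈ S, m h * (shiftBot h : ℝ) < 0) :
    ∃ C : ℝ, ∀ x N, ∑ n ∈ Finset.range N,
      (stepOp S m ^ n) ({z : Vertex | |z.1| ≤ M}.indicator 1) x ≤ C := by
  obtain ⟨g, hg⟩ := exists_forall_act_eq_translate (-(⌈2 * M⌉ + 1))
  refine hS.sum_stepOp_pow_indicator_le_of_drift (p := fun z => z.1 + M) hf (fun h hh z hz => ?_)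
    (fun z hz => ?_) (g := g) fun z hz => ?_
  · rw [hM.act_bot hh (by linarith), translate]
    ring
  · have := (abs_le.1 (show |z.1| ≤ M from hz)).1
    linarith
  · have h1 := (abs_le.1 (show |z.1| ≤ M from hz)).2
    have h2 := Int.le_ceil (2 * M)
    simp only [hg, translate]
    push_cast
    linarith

lemma IsStepWeight.sum_stepOp_pow_indicator_abs_le_of_top (hS : IsStepWeight S m)
    (hM : IsStepBound S M) (hf : 0 < ∑ h ∈ S, m h * (shiftTop h : ℝ)) :
    ∃ C : ℝ, ∀ x N, ∑ n ∈ Finset.range N,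
      (stepOp S m ^ n) ({z : Vertex | |z.1| ≤ M}.indicator 1) x ≤ C := by
  obtain ⟨g, hg⟩ := exists_forall_act_eq_translate (⌈2 * M⌉ + 1)
  refine hS.sum_stepOp_pow_indicator_le_of_drift (p := fun z => M - z.1)
    (f := fun h => -(shiftTop h : ℝ)) ?_ (fun h hh z hz => ?_)
    (fun z hz => ?_) (g := g) fun z hz => ?_
  · simp only [mul_neg, Finset.sum_neg_distrib]
    linarith
  · rw [hM.act_top hh (by linarith), translate]
    ring
  · have := (abs_le.1 (show |z.1| ≤ M from hz)).2
    linarith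
  · have h1 := (abs_le.1 (show |z.1| ≤ M from hz)).1
    have h2 := Int.le_ceil (2 * M)
    simp only [hg, translate]
    push_cast
    linarith

/-! ## The limits of sample paths -/

section Paths

variable {x : ℕ → Vertex} {h : ℕ → FTilde}

lemma eq_translate_sum (hx : ∀ n, x (n + 1) = act (x n) (h n)) {N : ℕ} {f : FTilde → ℤ}
    (hf : ∀ n, N ≤ n → act (x n) (h n) = translate (x n) (f (h n))) (n : ℕ) (hn : N ≤ n) :
    x n = translate (x N) (∑ i ∈ Finset.range n, f (h i) - ∑ i ∈ Finset.range N, f (h i)) := by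
  induction n, hn using Nat.le_induction with
  | base => rw [sub_self, translate_zero]
  | succ n hn ih =>
    rw [hx, hf n hn]
    nth_rewrite 1 [ih]
    rw [translate_translate, Finset.sum_range_succ]
    congr 1
    ring

lemma bddAbove_range_of_eventually_le {a : ℕ → ℝ} {c : ℝ} {N : ℕ} (h : ∀ n, N ≤ n → a n ≤ c) :
    BddAbove (Set.range a) :=
  Filter.IsBoundedUnder.bddAbove_range ⟨c, eventually_map.2 (eventually_atTop.2 ⟨N, h⟩)⟩

lemma IsStepBound.eq_translate_sum_bot (hM : IsStepBound S M)
    (hx : ∀ n, x (n + 1) = act (x n) (h n)) (hh : ∀ n, h n ∈ S) {N : ℕ}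
    (hlt : ∀ n, N ≤ n → (x n).1 < -M) (n : ℕ) (hn : N ≤ n) : x n = translate (x N)
      (∑ i ∈ Finset.range n, shiftBot (h i) - ∑ i ∈ Finset.range N, shiftBot (h i)) :=
  eq_translate_sum hx (fun n hn => hM.act_bot (hh n) (hlt n hn).le) n hn

lemma IsStepBound.eq_translate_sum_top (hM : IsStepBound S M)
    (hx : ∀ n, x (n + 1) = act (x n) (h n)) (hh : ∀ n, h n ∈ S) {N : ℕ}
    (hlt : ∀ n, N ≤ n → M < (x n).1) (n : ℕ) (hn : N ≤ n) : x n = translate (x N)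
      (∑ i ∈ Finset.range n, shiftTop (h i) - ∑ i ∈ Finset.range N, shiftTop (h i)) :=
  eq_translate_sum hx (fun n hn => hM.act_top (hh n) (hlt n hn).le) n hn

/-- While the path stays below `-M`, the walk of the shifts differs from it by a constant. This
contradicts unboundedness when the drift at `-∞` is nonnegative. -/
lemma IsStepBound.bddAbove_of_bot (hM : IsStepBound S M)
    (hx : ∀ n, x (n + 1) = act (x n) (h n)) (hh : ∀ n, h n ∈ S) {N : ℕ}
    (hlt : ∀ n, N ≤ n → (x n).1 < -M) :
    BddAbove (Set.range fun n => ((∑ i ∈ Finset.range n, shiftBot (h i) : ℤ) : ℝ)) := by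
  refine bddAbove_range_of_eventually_le (N := N)
    (c := -M - (x N).1 + ((∑ i ∈ Finset.range N, shiftBot (h i) : ℤ) : ℝ)) fun n hn => ?_
  have h1 := hlt n hn
  rw [hM.eq_translate_sum_bot hx hh hlt n hn, translate] at h1
  push_cast at h1 ⊢
  linarith

lemma IsStepBound.bddAbove_of_top (hM : IsStepBound S M)
    (hx : ∀ n, x (n + 1) = act (x n) (h n)) (hh : ∀ n, h n ∈ S) {N : ℕ}
    (hlt : ∀ n, N ≤ n → M < (x n).1) :
    BddAbove (Set.range fun n => ((∑ i ∈ Finset.range n, -shiftTop (h i) : ℤ) : ℝ)) := by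
  refine bddAbove_range_of_eventually_le (N := N)
    (c := (x N).1 - M + ((∑ i ∈ Finset.range N, -shiftTop (h i) : ℤ) : ℝ)) fun n hn => ?_
  have h1 := hlt n hn
  rw [hM.eq_translate_sum_top hx hh hlt n hn, translate] at h1
  push_cast [Finset.sum_neg_distrib] at h1 ⊢
  linarith

lemma IsStepBound.mem_endsMinus (hM : IsStepBound S M)
    (hx : ∀ n, x (n + 1) = act (x n) (h n)) (hh : ∀ n, h n ∈ S) {ω : Ends}
    (hω : ConvergesToEnd x ω) (hcof : Tendsto x atTop cofinite) {N : ℕ}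
    (hlt : ∀ n, N ≤ n → (x n).1 < -M) : ω ∈ endsMinus :=
  mem_endsMinus_of_le hω hcof (z := x N) (c := -M) <| eventually_atTop.2
    ⟨N, fun n hn => ⟨(hlt n hn).le, _, hM.eq_translate_sum_bot hx hh hlt n hn⟩⟩

lemma IsStepBound.mem_endsPlus (hM : IsStepBound S M)
    (hx : ∀ n, x (n + 1) = act (x n) (h n)) (hh : ∀ n, h n ∈ S) {ω : Ends}
    (hω : ConvergesToEnd x ω) (hcof : Tendsto x atTop cofinite) {N : ℕ}
    (hlt : ∀ n, N ≤ n → M < (x n).1) : ω ∈ endsPlus :=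
  mem_endsPlus_of_le hω hcof (z := x N) (c := M) <| eventually_atTop.2
    ⟨N, fun n hn => ⟨(hlt n hn).le, _, hM.eq_translate_sum_top hx hh hlt n hn⟩⟩

/-- A path that leaves `[-M, M]` stays on one side of it. -/
lemma IsStepBound.eventually_bot_or_top (hM : IsStepBound S M)
    (hx : ∀ n, x (n + 1) = act (x n) (h n)) (hh : ∀ n, h n ∈ S)
    (hout : ∀ᶠ n in atTop, ¬ |(x n).1| ≤ M) :
    ∃ N, (∀ n, N ≤ n → (x n).1 < -M) ∨ ∀ n, N ≤ n → M < (x n).1 := by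
  obtain ⟨N, hN⟩ := eventually_atTop.1 hout
  have hpos := hM.pos
  have hstep : ∀ n, |(x (n + 1)).1 - (x n).1| ≤ M := fun n => by
    rw [hx]
    exact hM.abs_act_sub_le (hh n) _
  refine ⟨N, ?_⟩
  -- A step of length at most `M` cannot cross an interval of length `2 * M`.
  rcases lt_abs.1 (not_le.1 (hN N le_rfl)) with h0 | h0
  · right
    intro n hn
    induction n, hn using Nat.le_induction with
    | base => exact h0
    | succ n hn ih =>
      have h1 := abs_le.1 (hstep n)
      rcases lt_abs.1 (not_le.1 (hN (n + 1) (by omega))) with h2 | h2 <;> linarith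
  · left
    intro n hn
    induction n, hn using Nat.le_induction with
    | base => linarith
    | succ n hn ih =>
      have h1 := abs_le.1 (hstep n)
      rcases lt_abs.1 (not_le.1 (hN (n + 1) (by omega))) with h2 | h2 <;> linarith

lemma finite_translates (y : Vertex) (M : ℝ) :
    {z : Vertex | |z.1| ≤ M ∧ ∃ j : ℤ, z = translate y j}.Finite := by
  refine ((Set.finite_Icc ⌊-M - y.1⌋ ⌈M - y.1⌉).image (translate y)).subset ?_
  rintro _ ⟨hz, j, rfl⟩
  refine ⟨j, ⟨?_, ?_⟩, rfl⟩
  all_goals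
    have h1 := abs_le.1 hz
    simp only [translate] at h1
  · have h2 := Int.floor_le (-M - y.1)
    have : ((⌊-M - y.1⌋ : ℤ) : ℝ) ≤ j := by linarith
    exact_mod_cast this
  · have h2 := Int.le_ceil (M - y.1)
    have : (j : ℝ) ≤ ((⌈M - y.1⌉ : ℤ) : ℝ) := by linarith
    exact_mod_cast this

/-- If a transient path cannot stay forever on either side of `[-M, M]`, then its projection to
the skeleton is transient. -/
lemma IsStepBound.tendsto_retract (hM : IsStepBound S M)
    (hx : ∀ n, x (n + 1) = act (x n) (h n)) (hh : ∀ n, h n ∈ S)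
    (hcof : Tendsto x atTop cofinite)
    (hbot : ¬ BddAbove (Set.range fun n => ((∑ i ∈ Finset.range n, shiftBot (h i) : ℤ) : ℝ)))
    (htop : ¬ BddAbove (Set.range fun n => ((∑ i ∈ Finset.range n, -shiftTop (h i) : ℤ) : ℝ))) :
    Tendsto (fun n => retract (x n)) atTop cofinite := by
  refine le_cofinite_iff_eventually_ne.2 fun y => eventually_map.2 ?_
  obtain ⟨N, hN⟩ := eventually_atTop.1
    (hcof.eventually (finite_translates y M).compl_mem_cofinite)
  have hpos := hM.pos
  have hstep : ∀ n, |(x (n + 1)).1 - (x n).1| ≤ M := fun n => by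
    rw [hx]
    exact hM.abs_act_sub_le (hh n) _
  refine eventually_atTop.2 ⟨N, fun n hn hy => ?_⟩
  have hy' : ∃ j : ℤ, x n = translate y j := by
    obtain ⟨c, hc⟩ := exists_retract_eq_translate (x n)
    refine ⟨-c, ?_⟩
    rw [← hy, hc, translate_translate, add_neg_cancel, translate_zero]
  -- Only finitely many points of the coset `y + ℤ` lie in the strip, and the path has left them for
  -- good by time `N`.
  have hout : ∀ k, N ≤ k → (∃ j : ℤ, x k = translate y j) → M < |(x k).1| := fun k hk hj =>
    not_le.1 fun hle => hN k hk ⟨hle, hj⟩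
  rcases lt_abs.1 (hout n hn hy') with h0 | h0
  · have : ∀ k, n ≤ k → M < (x k).1 ∧ ∃ j : ℤ, x k = translate y j := by
      intro k hk
      induction k, hk using Nat.le_induction with
      | base => exact ⟨h0, hy'⟩
      | succ k hk ih =>
        obtain ⟨h1, j, hj⟩ := ih
        have h2 : ∃ j : ℤ, x (k + 1) = translate y j := by
          rw [hx, hM.act_top (hh k) h1.le, hj, translate_translate]
          exact ⟨_, rfl⟩
        refine ⟨?_, h2⟩
        have h3 := abs_le.1 (hstep k)
        rcases lt_abs.1 (hout (k + 1) (by omega) h2) with h4 | h4 <;> linarith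
    exact htop (hM.bddAbove_of_top hx hh fun k hk => (this k hk).1)
  · have : ∀ k, n ≤ k → (x k).1 < -M ∧ ∃ j : ℤ, x k = translate y j := by
      intro k hk
      induction k, hk using Nat.le_induction with
      | base => exact ⟨by linarith, hy'⟩
      | succ k hk ih =>
        obtain ⟨h1, j, hj⟩ := ih
        have h2 : ∃ j : ℤ, x (k + 1) = translate y j := by
          rw [hx, hM.act_bot (hh k) h1.le, hj, translate_translate]
          exact ⟨_, rfl⟩
        refine ⟨?_, h2⟩
        have h3 := abs_le.1 (hstep k)
        rcases lt_abs.1 (hout (k + 1) (by omega) h2) with h4 | h4 <;> linarith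
    exact hbot (hM.bddAbove_of_bot hx hh fun k hk => (this k hk).1)

end Paths

/-! ## Measurability of the limit end field -/

lemma countable_componentCompl (K : Finset Vertex) :
    Countable (schreier.ComponentCompl (K : Set Vertex)) :=
  inferInstanceAs (Countable (Quot _))

lemma measurableSet_comp_eq (K : Finset Vertex) (C : schreier.ComponentCompl (K : Set Vertex)) :
    MeasurableSet {ω : Ends | ω.comp K = C} := by
  let (K : Finset Vertex) : TopologicalSpace (schreier.ComponentCompl (K : Set Vertex)) := ⊥
  have (K : Finset Vertex) : DiscreteTopology (schreier.ComponentCompl (K : Set Vertex)) := ⟨rfl⟩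
  have hc : Continuous fun ω : Ends => ω.comp := continuous_induced_dom
  exact ((isOpen_discrete {C}).preimage ((continuous_apply K).comp hc)).measurableSet

/-- There are countably many finite sets of vertices, and each component space is countable and
discrete. The Borel structure on ends is therefore pulled back from the product σ-algebra. -/
lemma measurable_of_measurableSet_comp_eq {X : Type*} [MeasurableSpace X] {f : X → Ends}
    (hf : ∀ (K : Finset Vertex) (C : schreier.ComponentCompl (K : Set Vertex)),
      MeasurableSet {x | (f x).comp K = C}) : Measurable f := by
  let (K : Finset Vertex) : TopologicalSpace (schreier.ComponentCompl (K : Set Vertex)) := ⊥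
  have (K : Finset Vertex) : DiscreteTopology (schreier.ComponentCompl (K : Set Vertex)) := ⟨rfl⟩
  let (K : Finset Vertex) : MeasurableSpace (schreier.ComponentCompl (K : Set Vertex)) := ⊤
  have (K : Finset Vertex) : BorelSpace (schreier.ComponentCompl (K : Set Vertex)) :=
    ⟨borel_eq_top_of_discrete.symm⟩
  have := countable_componentCompl
  have e : borel Ends = MeasurableSpace.comap (fun ω : Ends => ω.comp) MeasurableSpace.pi := by
    rw [BorelSpace.measurable_eq (α := ∀ K : Finset Vertex,
      schreier.ComponentCompl (K : Set Vertex)), ← borel_comap]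
  have h : @Measurable _ _ _ (MeasurableSpace.comap (fun ω : Ends => ω.comp) MeasurableSpace.pi)
      f := by
    rw [measurable_comap_iff]
    exact measurable_pi_lambda _ fun K => measurable_to_countable' fun C => hf K C
  rwa [← e] at h

lemma measurableSet_singleton_ends (ω : Ends) : MeasurableSet ({ω} : Set Ends) := by
  have e : ({ω} : Set Ends) = ⋂ K : Finset Vertex, {ω' : Ends | ω'.comp K = ω.comp K} := by
    ext ω'
    simp only [Set.mem_singleton_iff, Set.mem_iInter, Set.mem_ofPred_eq]
    refine ⟨fun h K => by rw [h], fun h => Subtype.ext (funext fun K => h K.unop)⟩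
  rw [e]
  exact MeasurableSet.iInter fun K => measurableSet_comp_eq K _

/-- A sequence has at most one limit and there are countably many vertices, so such a set of ends is
countable. -/
lemma measurableSet_of_forall_exists_convergesToEnd {A : Set Ends} (f : Vertex → ℕ → Vertex)
    (h : ∀ ω ∈ A, ∃ y, ConvergesToEnd (f y) ω) : MeasurableSet A := by
  have hc : A.Countable := by
    have : Nonempty Vertex := ⟨halfVertex⟩
    choose! g hg using h
    refine Set.MapsTo.countable_of_injOn (t := Set.univ) (f := g) (fun _ _ => trivial)
      (fun ω hω ω' hω' e => ?_) Set.countable_univ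
    have h1 := hg ω hω
    rw [e] at h1
    exact h1.unique (hg ω' hω')
  rw [← Set.biUnion_of_singleton A]
  exact MeasurableSet.biUnion hc fun ω _ => measurableSet_singleton_ends ω

lemma measurableSet_endsMinus : MeasurableSet endsMinus :=
  measurableSet_of_forall_exists_convergesToEnd (fun y n => translate y (-(n : ℤ)))
    fun _ ⟨y, _, _, h⟩ => ⟨y, h⟩

lemma measurableSet_endsPlus : MeasurableSet endsPlus :=
  measurableSet_of_forall_exists_convergesToEnd (fun y n => translate y (n : ℤ))
    fun _ ⟨y, _, _, h⟩ => ⟨y, h⟩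

/-- The condition is a countable combination of cylinder sets. `endsNearSkeleton` therefore stands
in for `endsSkeleton`, whose definition quantifies over the ends of the skeleton. -/
lemma measurableSet_endsNearSkeleton : MeasurableSet endsNearSkeleton := by
  have e : endsNearSkeleton = ⋂ K : Finset Vertex, ⋃ y : ↥skeletonVertices,
      {ω : Ends | y.1 ∈ (ω.comp K).supp} := by
    ext ω
    simp [endsNearSkeleton]
  rw [e]
  refine MeasurableSet.iInter fun K => MeasurableSet.iUnion fun y => ?_
  by_cases hy : y.1 ∈ (K : Set Vertex)
  · convert MeasurableSet.empty
    exact Set.eq_empty_of_forall_notMem fun ω hω => hω.1 hy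
  · convert measurableSet_comp_eq K (schreier.componentComplMk hy) using 1
    ext ω
    exact ⟨fun ⟨_, h⟩ => h.symm, fun h => ⟨hy, h.symm⟩⟩

lemma limitEnd_eq {x : ℕ → Vertex} {ω : Ends} (h : ConvergesToEnd x ω) : limitEnd x = ω :=
  (Classical.epsilon_spec (p := fun ω => ConvergesToEnd x ω) ⟨ω, h⟩).unique h

lemma measurableSet_eventually_act_mem (x : Vertex) (T : Set Vertex) :
    MeasurableSet {g : ℕ → FTilde | ∀ᶠ n in atTop, act x (g n) ∈ T} := by
  have e : {g : ℕ → FTilde | ∀ᶠ n in atTop, act x (g n) ∈ T} =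
      ⋃ N : ℕ, ⋂ n : ℕ, ⋂ _ : N ≤ n, {g | act x (g n) ∈ T} := by
    ext g
    simp [eventually_atTop]
  rw [e]
  exact MeasurableSet.iUnion fun N => MeasurableSet.iInter fun n => MeasurableSet.iInter fun _ =>
    measurable_pi_apply (X := fun _ : ℕ => FTilde) n
      (MeasurableSet.of_discrete (s := {g : FTilde | act x g ∈ T}))

lemma measurable_endField : Measurable endField := by
  refine measurable_pi_lambda _ fun x => ?_
  have := countable_componentCompl
  set D : Set (ℕ → FTilde) := {g | ∃ ω, ConvergesToEnd (fun n => act x (g n)) ω}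
  have hD : MeasurableSet D := by
    have e : D = ⋂ K : Finset Vertex, ⋃ C : schreier.ComponentCompl (K : Set Vertex),
        {g | ∀ᶠ n in atTop, act x (g n) ∈ C.supp} := by
      ext g
      simp only [D, Set.mem_iInter, Set.mem_iUnion, Set.mem_ofPred_eq]
      exact ⟨fun ⟨ω, h⟩ K => ⟨ω.comp K, h K⟩, exists_convergesToEnd_of_eventually_mem⟩
    rw [e]
    exact MeasurableSet.iInter fun K => MeasurableSet.iUnion fun C =>
      measurableSet_eventually_act_mem x _
  -- On divergent paths the predicate given to `epsilon` is identically false, so the default end is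
  -- the same for all of them.
  have hnot : ∀ g ∉ D, endField g x = Classical.epsilon fun _ => False := by
    intro g hg
    have : (fun ω => ConvergesToEnd (fun n => act x (g n)) ω) = fun _ => False :=
      funext fun ω => eq_false fun h => hg ⟨ω, h⟩
    rw [endField, limitEnd, this]
  refine measurable_of_measurableSet_comp_eq fun K C => ?_
  have e : {g : ℕ → FTilde | (endField g x).comp K = C} =
      D ∩ {g | ∀ᶠ n in atTop, act x (g n) ∈ C.supp} ∪
        Dᶜ ∩ {_g | (Classical.epsilon fun _ : Ends => False).comp K = C} := by
    ext g
    by_cases hg : g ∈ D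
    · obtain ⟨ω, hω⟩ := id hg
      have h1 : endField g x = ω := limitEnd_eq hω
      simp only [Set.mem_ofPred_eq, Set.mem_union, Set.mem_inter_iff, hg, true_and,
        Set.mem_compl_iff, not_true_eq_false, false_and, or_false, h1]
      refine ⟨fun h => h ▸ hω K, fun h => ?_⟩
      obtain ⟨n, h2, h3⟩ := ((hω K).and h).exists
      exact eq_of_mem_supp h2 h3
    · simp [hg, hnot g hg]
  rw [e]
  exact (hD.inter (measurableSet_eventually_act_mem x _)).union
    (hD.compl.inter (MeasurableSet.const _))

lemma limitMeasure_compl_eq_zero {μ : PMF FTilde} {A : Set Ends} (hA : MeasurableSet A)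
    (h : ∀ᵐ g ∂pathMeasure μ, ∀ x, ∃ ω ∈ A, ConvergesToEnd (fun n => act x (g n)) ω) :
    limitMeasure μ (endFields A)ᶜ = 0 := by
  have hm : MeasurableSet {φ : Vertex → Ends | ∀ x, φ x ∈ A} := by
    have e : {φ : Vertex → Ends | ∀ x, φ x ∈ A} = ⋂ x, (fun φ => φ x) ⁻¹' A := by
      ext φ
      simp
    rw [e]
    exact MeasurableSet.iInter fun x => measurable_pi_apply x hA
  refine (ae_map_iff measurable_endField.aemeasurable hm).2 ?_
  filter_upwards [h] with g hg x
  obtain ⟨ω, hω, hlim⟩ := hg x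
  rwa [endField, limitEnd_eq hlim]

/-- The increments are recovered measurably from the positions. Almost sure statements thus pass
between the two spaces with no measurability condition on the event. -/
lemma measurableEmbedding_positions : MeasurableEmbedding positions := by
  let q : (ℕ → FTilde) → ℕ → FTilde := fun g n => (g n)⁻¹ * g (n + 1)
  have hq : Measurable q := by
    refine measurable_pi_lambda _ fun n => ?_
    have h : Measurable fun p : FTilde × FTilde => p.1⁻¹ * p.2 := measurable_of_countable _
    exact h.comp ((measurable_pi_apply (X := fun _ : ℕ => FTilde) n).prodMk
      (measurable_pi_apply (n + 1)))
  refine MeasurableEmbedding.of_measurable_inverse measurable_positions ?_ hq fun h => ?_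
  · have e : Set.range positions = {g | g 0 = 1} := by
      ext g
      refine ⟨?_, fun hg => ⟨q g, funext fun n => ?_⟩⟩
      · rintro ⟨h, rfl⟩
        rfl
      · induction n with
        | zero => exact hg.symm
        | succ n ih => rw [positions, ih, mul_inv_cancel_left]
    rw [e]
    exact measurable_pi_apply (X := fun _ : ℕ => FTilde) 0
      (MeasurableSet.of_discrete (s := {(1 : FTilde)}))
  · funext n
    exact inv_mul_cancel_left _ _

lemma ae_pathMeasure_iff {μ : PMF FTilde} {p : (ℕ → FTilde) → Prop} :
    (∀ᵐ g ∂pathMeasure μ, p g) ↔ ∀ᵐ h ∂stepMeasure μ, p (positions h) :=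
  measurableEmbedding_positions.ae_map_iff

/-! ## Almost sure limits -/

/-- The shift is additive, so vanishing on a generating support would force it to vanish on `elA`.
-/
lemma exists_mem_support_shiftBot_ne_zero (hfin : μ.support.Finite)
    (hgen : Subsemigroup.closure μ.support = ⊤) : ∃ h ∈ μ.support, shiftBot h ≠ 0 := by
  by_contra! hall
  have h0 : ∀ g, shiftBot g = 0 := fun g => (isStepWeight hfin hgen).induction
    (fun h hh => hall h (by simpa using hh))
    (fun f g hf hg => by rw [shiftBot_mul, hf, hg, add_zero]) g
  have := h0 elA
  rw [shiftBot_elA] at this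
  norm_num at this

lemma exists_mem_support_shiftTop_ne_zero (hfin : μ.support.Finite)
    (hgen : Subsemigroup.closure μ.support = ⊤) : ∃ h ∈ μ.support, shiftTop h ≠ 0 := by
  by_contra! hall
  have h0 : ∀ g, shiftTop g = 0 := fun g => (isStepWeight hfin hgen).induction
    (fun h hh => hall h (by simpa using hh))
    (fun f g hf hg => by rw [shiftTop_mul, hf, hg, add_zero]) g
  have := h0 elA
  rw [shiftTop_elA] at this
  norm_num at this

/-- Almost surely all increments belong to the support, and all orbits are transient and
converge. -/
lemma ae_convergesToEnd (hfin : μ.support.Finite)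
    (hgen : Subsemigroup.closure μ.support = ⊤) :
    ∀ᵐ h ∂stepMeasure μ, (∀ n, h n ∈ hfin.toFinset) ∧ ∀ x,
      Tendsto (fun n => act x (positions h n)) atTop cofinite ∧
        ∃ ω, ConvergesToEnd (fun n => act x (positions h n)) ω := by
  filter_upwards [ae_forall_mem_support μ, ae_tendsto_cofinite hfin hgen] with h h1 h2
  have h3 : ∀ n, h n ∈ hfin.toFinset := fun n => by simpa using h1 n
  exact ⟨h3, fun x => ⟨h2 x, exists_convergesToEnd_of_steps (h2 x) hfin.toFinset
    fun n => ⟨h n, h3 n, rfl⟩⟩⟩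

/-- If one of the two sides is attracting, then almost surely every orbit converges to an end of
negative type, the walk of the shifts at `-∞` being bounded above, or to an end of positive type,
the walk of the shifts at `+∞` being bounded below. -/
lemma ae_exists_mem_endsMinus_or_endsPlus (hfin : μ.support.Finite)
    (hgen : Subsemigroup.closure μ.support = ⊤)
    (hdrift : ∑ h ∈ hfin.toFinset, (μ h).toReal * (shiftBot h : ℝ) < 0 ∨
      0 < ∑ h ∈ hfin.toFinset, (μ h).toReal * (shiftTop h : ℝ)) :
    ∀ᵐ h ∂stepMeasure μ, ∀ x, ∃ ω, ConvergesToEnd (fun n => act x (positions h n)) ω ∧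
      (ω ∈ endsMinus ∧
          BddAbove (Set.range fun n => ((∑ i ∈ Finset.range n, shiftBot (h i) : ℤ) : ℝ)) ∨
        ω ∈ endsPlus ∧
          BddAbove (Set.range fun n => ((∑ i ∈ Finset.range n, -shiftTop (h i) : ℤ) : ℝ))) := by
  have hS := isStepWeight hfin hgen
  obtain ⟨M, hM⟩ := exists_isStepBound hfin.toFinset
  obtain ⟨C, hC⟩ := hdrift.elim (hS.sum_stepOp_pow_indicator_abs_le_of_bot hM)
    (hS.sum_stepOp_pow_indicator_abs_le_of_top hM)
  have hout : ∀ᵐ h ∂stepMeasure μ, ∀ x, ∀ᶠ n in atTop,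
      act x (positions h n) ∉ {z : Vertex | |z.1| ≤ M} :=
    ae_all_iff.2 fun x => ae_eventually_act_notMem hfin hgen _ x (hC x)
  filter_upwards [ae_convergesToEnd hfin hgen, hout] with h ⟨h1, h2⟩ h3 x
  obtain ⟨hcof, ω, hω⟩ := h2 x
  refine ⟨ω, hω, ?_⟩
  have hx : ∀ n, act x (positions h (n + 1)) = act (act x (positions h n)) (h n) := fun _ => rfl
  obtain ⟨N, hN | hN⟩ := hM.eventually_bot_or_top hx h1 (h3 x)
  · exact Or.inl ⟨hM.mem_endsMinus hx h1 hω hcof hN, hM.bddAbove_of_bot hx h1 hN⟩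
  · exact Or.inr ⟨hM.mem_endsPlus hx h1 hω hcof hN, hM.bddAbove_of_top hx h1 hN⟩

lemma ae_not_bddAbove_shiftBot (hfin : μ.support.Finite)
    (hgen : Subsemigroup.closure μ.support = ⊤)
    (hdrift : 0 ≤ ∑ h ∈ hfin.toFinset, (μ h).toReal * (shiftBot h : ℝ)) :
    ∀ᵐ h ∂stepMeasure μ,
      ¬ BddAbove (Set.range fun n => ((∑ i ∈ Finset.range n, shiftBot (h i) : ℤ) : ℝ)) :=
  ae_not_bddAbove_sum hfin (exists_mem_support_shiftBot_ne_zero hfin hgen) hdrift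

lemma ae_not_bddAbove_shiftTop (hfin : μ.support.Finite)
    (hgen : Subsemigroup.closure μ.support = ⊤)
    (hdrift : ∑ h ∈ hfin.toFinset, (μ h).toReal * (shiftTop h : ℝ) ≤ 0) :
    ∀ᵐ h ∂stepMeasure μ,
      ¬ BddAbove (Set.range fun n => ((∑ i ∈ Finset.range n, -shiftTop (h i) : ℤ) : ℝ)) := by
  obtain ⟨h, hh, hne⟩ := exists_mem_support_shiftTop_ne_zero hfin hgen
  refine ae_not_bddAbove_sum hfin (f := fun h => -shiftTop h) ⟨h, hh, neg_ne_zero.2 hne⟩ ?_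
  simp only [Int.cast_neg, mul_neg, Finset.sum_neg_distrib]
  linarith

/-- If neither side is attracting, then almost surely every orbit converges to an end of the
skeleton. -/
lemma ae_exists_mem_endsNearSkeleton (hfin : μ.support.Finite)
    (hgen : Subsemigroup.closure μ.support = ⊤)
    (hbot : 0 ≤ ∑ h ∈ hfin.toFinset, (μ h).toReal * (shiftBot h : ℝ))
    (htop : ∑ h ∈ hfin.toFinset, (μ h).toReal * (shiftTop h : ℝ) ≤ 0) :
    ∀ᵐ h ∂stepMeasure μ, ∀ x, ∃ ω ∈ endsNearSkeleton,
      ConvergesToEnd (fun n => act x (positions h n)) ω := by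
  obtain ⟨M, hM⟩ := exists_isStepBound hfin.toFinset
  filter_upwards [ae_convergesToEnd hfin hgen, ae_not_bddAbove_shiftBot hfin hgen hbot,
    ae_not_bddAbove_shiftTop hfin hgen htop] with h ⟨h1, h2⟩ h3 h4 x
  obtain ⟨hcof, ω, hω⟩ := h2 x
  exact ⟨ω, mem_endsNearSkeleton hω (hM.tendsto_retract (fun _ => rfl) h1 hcof h3 h4), hω⟩

end ThompsonEnds

/-! ### The four cases of the theorem -/

open ThompsonEnds in
theorem mainTheorem7 (μ : PMF FTilde) (hfin : μ.support.Finite)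
    (hgen : Subsemigroup.closure μ.support = ⊤) (α β : ℝ)
    (hα : α = barycentre (imageMeasure chiA μ)) (hβ : β = barycentre (imageMeasure chiB μ)) :
    (∀ᵐ g ∂(pathMeasure μ), ∀ x : Vertex, ∃ ω : Ends,
        ConvergesToEnd (fun n => act x (g n)) ω) ∧
      MeasureTheory.IsProbabilityMeasure (limitMeasure μ) ∧
      (0 < α → α + β < 0 → limitMeasure μ (endFields (endsMinus ∪ endsPlus))ᶜ = 0) ∧
      (0 < α → 0 ≤ α + β → limitMeasure μ (endFields endsMinus)ᶜ = 0) ∧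
      (α ≤ 0 → α + β < 0 → limitMeasure μ (endFields endsPlus)ᶜ = 0) ∧
      (α ≤ 0 → 0 ≤ α + β → limitMeasure μ (endFields endsSkeleton)ᶜ = 0) := by
  -- `chiA` is minus the shift at `-∞`, and `chiA` plus `chiB` is minus the shift at `+∞`. Hence `α
  -- > 0` makes `-∞` attracting and `α + β < 0` makes `+∞` attracting.
  have hbot : ∑ h ∈ hfin.toFinset, (μ h).toReal * (shiftBot h : ℝ) = -α := by
    rw [hα, barycentre_imageMeasure hfin, ← Finset.sum_neg_distrib]
    refine Finset.sum_congr rfl fun h _ => ?_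
    have e : (chiA h).toAdd = -shiftBot h := rfl
    rw [e]
    push_cast
    ring
  have htop : ∑ h ∈ hfin.toFinset, (μ h).toReal * (shiftTop h : ℝ) = -(α + β) := by
    rw [hα, hβ, barycentre_imageMeasure hfin, barycentre_imageMeasure hfin,
      ← Finset.sum_add_distrib, ← Finset.sum_neg_distrib]
    refine Finset.sum_congr rfl fun h _ => ?_
    have e : (chiA h).toAdd = -shiftBot h := rfl
    have e' : (chiB h).toAdd = shiftBot h - shiftTop h := rfl
    rw [e, e']
    push_cast
    ring
  refine ⟨ae_pathMeasure_iff.2 ?_, Measure.isProbabilityMeasure_map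
    measurable_endField.aemeasurable, fun h1 h2 => ?_, fun h1 h2 => ?_, fun h1 h2 => ?_,
    fun h1 h2 => ?_⟩
  · filter_upwards [ae_convergesToEnd hfin hgen] with h hh x
    exact (hh.2 x).2
  · refine limitMeasure_compl_eq_zero (measurableSet_endsMinus.union measurableSet_endsPlus)
      (ae_pathMeasure_iff.2 ?_)
    filter_upwards [ae_exists_mem_endsMinus_or_endsPlus hfin hgen (Or.inl (by linarith))]
      with h hh x
    obtain ⟨ω, hω, hcases⟩ := hh x
    exact ⟨ω, hcases.imp And.left And.left, hω⟩
  · refine limitMeasure_compl_eq_zero measurableSet_endsMinus (ae_pathMeasure_iff.2 ?_)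
    filter_upwards [ae_exists_mem_endsMinus_or_endsPlus hfin hgen (Or.inl (by linarith)),
      ae_not_bddAbove_shiftTop hfin hgen (by linarith)] with h hh hnot x
    obtain ⟨ω, hω, hcases⟩ := hh x
    exact ⟨ω, (hcases.resolve_right fun h => hnot h.2).1, hω⟩
  · refine limitMeasure_compl_eq_zero measurableSet_endsPlus (ae_pathMeasure_iff.2 ?_)
    filter_upwards [ae_exists_mem_endsMinus_or_endsPlus hfin hgen (Or.inr (by linarith)),
      ae_not_bddAbove_shiftBot hfin hgen (by linarith)] with h hh hnot x
    obtain ⟨ω, hω, hcases⟩ := hh x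
    exact ⟨ω, (hcases.resolve_left fun h => hnot h.2).1, hω⟩
  -- Passing to the smaller measurable set avoids any measurability claim about `endsSkeleton`.
  · have hsub : (endFields endsSkeleton)ᶜ ⊆ (endFields endsNearSkeleton)ᶜ :=
      Set.compl_subset_compl.2 fun φ hφ x => endsNearSkeleton_subset (hφ x)
    refine measure_mono_null hsub (limitMeasure_compl_eq_zero measurableSet_endsNearSkeleton
      (ae_pathMeasure_iff.2 ?_))
    exact ae_exists_mem_endsNearSkeleton hfin hgen (by linarith) (by linarith)
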